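/- Consider the planar 4-body problem with arbitrary masses $m_1,m_2,m_3,m_4>0$, the bodies $1,2$ and $3,4$ forming two binaries. Let $Q_1,Q_2\in\mathbb{C}$ be the difference vectors of the binaries, $x\in\mathbb{C}$ the difference vector of their centres of mass, and $P_1,P_2,y$ the conjugate momenta. With $M_1=\frac{m_1m_2}{m_1+m_2}$, $M_2=\frac{m_3m_4}{m_3+m_4}$, $k_1=m_1m_2$, $k_2=m_3m_4$, $\mu=\frac{m_1+m_2+m_3+m_4}{(m_1+m_2)(m_3+m_4)}$, the Hamiltonian is $$H=\sum_{j=1}^2\Big(\tfrac{1}{2M_j}|P_j|^2-\tfrac{k_j}{|Q_j|}\Big)+\tfrac12\mu|y|^2-\hat K(Q_1,Q_2,x),$$ where $\hat K$ is the sum of the four Newtonian terms $m_am_b/|q_a-q_b|$ coupling the two binaries. Put $a_j=16k_j^2M_j$, and introduce Levi-Civita variables $z_j,u_j$ by $4k_jM_jQ_j=\tfrac12 z_j^2$, $P_j=4k_jM_j\,\bar z_j^{-1}u_j$. The generalised Levi-Civita coordinates are $(\zeta_1,\zeta_2,h_1,h_2,\Gamma_1,\Gamma_2,x,y)$ with $$\zeta_j=I_j+iL_j=a_j^{-1/3}\bar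 u_jz_j,\qquad h_j=a_j^{2/3}|z_j|^{-2}(|u_j|^2-1),\qquad \Gamma_j=u_j/|u_j|=e^{i\theta_j},$$ and we use the angles $\theta_j\in\mathbb{R}$ as coordinates for $\Gamma_j$, so that the phase space is $\mathbb{C}^2\times\mathbb{R}^2\times\mathbb{R}^2\times\mathbb{C}^2\cong\mathbb{R}^{12}$. Let $X=|\zeta_1|^2|\zeta_2|^2X_H$ be the rescaled Hamiltonian vector field in these coordinates. It extends smoothly to a neighbourhood of the 8-dimensional set of simultaneous binary collisions $\mathscr{C}=\{\zeta_1=\zeta_2=0,\ x\neq0\}$, on which it vanishes. (i) Let $U$ be an open set that meets $\mathscr{C}$ (for example, a tubular neighbourhood of $\mathscr{C}$). There is no smooth ($C^\infty$) foliation of $U$ by 4-dimensional leaves that are invariant under $X$ (that is, $X$ is tangent to the leaves) and normal to $\mathscr{C}$ (that is, at each point of $U\cap\mathscr{C}$ the tangent space of the leaf is complementary to that of $\mathscr{C}$). (ii) Let $p\in\mathscr{C}$ and $j\in\{1,2\}$. There is no $C^\infty$ real function $F$ on an open neighbourhood of $p$ such that $\partial F/\partial h_k(p)=\delta_{jk}$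 for $k=1,2$ (as is the case if $F=h_j$ on $\mathscr{C}$, or if $F$ is the image of $h_j$ under a change of coordinates tangent to the identity at $p$) and such that $F$ is an invariant of $X$ at order $8$ in $I_1,L_1,I_2,L_2$, that is, $$dF(X)(q)=O\big(|\zeta(q)|^{10}\big)\qquad\text{as } q\to p,$$ where $\zeta(q)=(\zeta_1,\zeta_2)$. In particular, there is no smooth $F$ of this kind that is an exact first integral of $X$ near $p$. -/

import Mathlib

open scoped ComplexConjugate ContDiff Topology

noncomputable section

namespace FourBody

/-! ## Constants of the planar 4-body problem

The masses are `m 0, m 1` (first binary) and `m 2, m 3` (second binary); binaries are indexed by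
`j : Fin 2`, and `1 - j` is the other binary. -/

/-- Reduced masses `M_j` of the two binaries. -/
def redMass (m : Fin 4 → ℝ) : Fin 2 → ℝ :=
  ![m 0 * m 1 / (m 0 + m 1), m 2 * m 3 / (m 2 + m 3)]

/-- `k_j`, the product of the two masses of the `j`-th binary. -/
def massProd (m : Fin 4 → ℝ) : Fin 2 → ℝ := ![m 0 * m 1, m 2 * m 3]

/-- `a_j = 16 k_j² M_j`. -/
def aConst (m : Fin 4 → ℝ) (j : Fin 2) : ℝ := 16 * massProd m j ^ 2 * redMass m j

/-- `μ`, the inverse of the reduced mass of the two centres of mass. -/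
def muConst (m : Fin 4 → ℝ) : ℝ := (m 0 + m 1 + m 2 + m 3) / ((m 0 + m 1) * (m 2 + m 3))

/-- The coupling potential `K̂(Q₁, Q₂, x)`: `Q_j` is the difference vector in the `j`-th binary and
`x` the difference vector of the two centres of mass. -/
def coupling (m : Fin 4 → ℝ) (Q : Fin 2 → ℂ) (x : ℂ) : ℝ :=
  let c₁ : ℂ := ((redMass m 0 / m 1 : ℝ) : ℂ)
  let c₂ : ℂ := ((redMass m 0 / m 0 : ℝ) : ℂ)
  let c₃ : ℂ := ((redMass m 1 / m 3 : ℝ) : ℂ)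
  let c₄ : ℂ := ((redMass m 1 / m 2 : ℝ) : ℂ)
  m 0 * m 2 / ‖x + c₂ * Q 0 - c₄ * Q 1‖ + m 0 * m 3 / ‖x + c₂ * Q 0 + c₃ * Q 1‖
    + m 1 * m 2 / ‖x - c₁ * Q 0 - c₄ * Q 1‖ + m 1 * m 3 / ‖x - c₁ * Q 0 + c₃ * Q 1‖

/-! ## Levi-Civita variables

With `4 k_j M_j Q_j = z_j² / 2` and `P_j / (4 k_j M_j) = u_j / conj z_j` the Hamiltonian is
`H(z, x, u, y) = ∑ j, a_j (|u_j|² - 1) / (2 |z_j|²) + μ |y|² / 2 - K(z₁, z₂, x)`,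
and `(z_j, u_j)`, `(x, y)` are conjugate for the real inner product on `ℂ`. -/

/-- The coupling potential in Levi-Civita variables. -/
def couplingLC (m : Fin 4 → ℝ) (z : Fin 2 → ℂ) (x : ℂ) : ℝ :=
  coupling m (fun j => z j ^ 2 / 2 / ((4 * massProd m j * redMass m j : ℝ) : ℂ)) x

/-- Real gradient of the coupling potential with respect to `z_j`, as a complex number
(that is, `2 ∂K/∂(conj z_j)`). -/
def gradZ (m : Fin 4 → ℝ) (z : Fin 2 → ℂ) (x : ℂ) (j : Fin 2) : ℂ :=
  gradient (fun w : ℂ => couplingLC m (Function.update z j w) x) (z j)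

/-- Real gradient of the coupling potential with respect to `x` (that is, `2 ∂K/∂(conj x)`). -/
def gradX (m : Fin 4 → ℝ) (z : Fin 2 → ℂ) (x : ℂ) : ℂ :=
  gradient (fun w : ℂ => couplingLC m z w) x

/-! ## Generalised Levi-Civita coordinates -/

/-- Phase space in generalised Levi-Civita coordinates, `p = (ζ, h, θ, x, y)`, of real
dimension 12. The angles are lifted to `ℝ`: the direction of `u_j` is `Γ_j = exp (i θ_j)`. -/
abbrev Phase : Type := (Fin 2 → ℂ) × (Fin 2 → ℝ) × (Fin 2 → ℝ) × ℂ × ℂ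

namespace Phase

/-- `ζ_j = a_j^(-1/3) (conj u_j) z_j = I_j + i L_j`. -/
def zeta (p : Phase) : Fin 2 → ℂ := p.1

/-- The (scaled) intrinsic energies `h_j = a_j^(2/3) (|u_j|² - 1) / |z_j|²`. -/
def h (p : Phase) : Fin 2 → ℝ := p.2.1

/-- The angles `θ_j` of `u_j`. -/
def theta (p : Phase) : Fin 2 → ℝ := p.2.2.1

/-- The difference vector `x` of the centres of mass. -/
def x (p : Phase) : ℂ := p.2.2.2.1

/-- The momentum `y` conjugate to `x`. -/
def y (p : Phase) : ℂ := p.2.2.2.2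

/-- `U_j = |u_j|`, the solution of `|ζ_j|² h_j = U_j² (U_j² - 1)` with value `1` at `ζ_j = 0`. -/
def U (p : Phase) (j : Fin 2) : ℝ :=
  √((1 + √(1 + 4 * p.h j * ‖p.zeta j‖ ^ 2)) / 2)

/-- `u_j = U_j Γ_j`. -/
def u (p : Phase) (j : Fin 2) : ℂ := (p.U j : ℂ) * Complex.exp ((p.theta j : ℂ) * Complex.I)

/-- `z_j = a_j^(1/3) U_j⁻¹ Γ_j ζ_j`. -/
def z (m : Fin 4 → ℝ) (p : Phase) (j : Fin 2) : ℂ :=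
  ((aConst m j ^ (1 / 3 : ℝ) / p.U j : ℝ) : ℂ) * Complex.exp ((p.theta j : ℂ) * Complex.I)
    * p.zeta j

end Phase

/-- The vector field `X = |ζ₁|² |ζ₂|² X_H`: the Hamiltonian vector field
`z_j' = a_j u_j / |z_j|²`, `u_j' = a_j (|u_j|² - 1) z_j / |z_j|⁴ + ∇_{z_j} K`, `x' = μ y`,
`y' = ∇_x K` of the planar 4-body problem, written in the coordinates `(ζ, h, θ, x, y)` and
multiplied by `|ζ₁|² |ζ₂|²`, which makes it regular at `ζ_j = 0`. -/
def field (m : Fin 4 → ℝ) (p : Phase) : Phase :=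
  let g : Fin 2 → ℂ := gradZ m (p.z m) p.x
  (fun j => ((‖p.zeta (1 - j)‖ ^ 2 : ℝ) : ℂ) *
      (((p.U j ^ 2 * (2 * p.U j ^ 2 - 1) : ℝ) : ℂ)
        + ((aConst m j ^ (-(1 / 3) : ℝ) * ‖p.zeta j‖ ^ 2 : ℝ) : ℂ) * (p.z m j * conj (g j))),
   fun j => ‖p.zeta (1 - j)‖ ^ 2 * (2 * p.U j ^ 2 * (p.u j * conj (g j)).re),
   fun j => ‖p.zeta (1 - j)‖ ^ 2 *
      (p.h j * (p.zeta j).im - ‖p.zeta j‖ ^ 2 * (p.u j * conj (g j)).im / p.U j ^ 2),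
   ((‖p.zeta 0‖ ^ 2 * ‖p.zeta 1‖ ^ 2 * muConst m : ℝ) : ℂ) * p.y,
   ((‖p.zeta 0‖ ^ 2 * ‖p.zeta 1‖ ^ 2 : ℝ) : ℂ) * gradX m (p.z m) p.x)

/-- The set of simultaneous binary collisions: `ζ₁ = ζ₂ = 0`, while the two binaries are
apart. -/
def collisionSet : Set Phase := {p | p.zeta = 0 ∧ p.x ≠ 0}

/-- The tangent space of the collision set (the same at each of its points): `ζ = 0`. -/
def collisionTangent : Submodule ℝ Phase :=
  LinearMap.ker (LinearMap.fst ℝ (Fin 2 → ℂ) ((Fin 2 → ℝ) × (Fin 2 → ℝ) × ℂ × ℂ))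

/-- The coordinate direction `∂/∂h_k`. -/
def dirH (k : Fin 2) : Phase := (0, Pi.single k 1, 0, 0, 0)

/-- `F` is invariant at order `n` in `ζ` near `p`, for a vector field `X` that vanishes to second
order on `ζ = 0`: the derivative of `F` along `X` has no terms of degree `≤ n + 1` in `ζ`, the
degrees in which the terms of `F` of degree `≤ n` meet the leading terms of `X`. -/
def IsInvariantAtOrder (X : Phase → Phase) (F : Phase → ℝ) (n : ℕ) (p : Phase) : Prop :=
  (fun q => fderiv ℝ F q (X q)) =O[𝓝 p] fun q => ‖q.zeta‖ ^ (n + 2)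

end FourBody

/-- A smooth foliation of an open set `U` of a normed space `E`, given by an atlas of local
submersions to the model `N` of the transverse directions: plaques are the fibres of the charts, and
any two charts have locally the same fibres. The codimension of the leaves is `dim N`. -/
structure SmoothFoliation {E : Type*} [NormedAddCommGroup E] [NormedSpace ℝ E] (U : Set E)
    (N : Type*) [NormedAddCommGroup N] [NormedSpace ℝ N] where
  /-- Index set of the atlas. -/
  ι : Type
  /-- Domains of the charts. -/
  dom : ι → Set E
  /-- The local submersions. -/
  chart : ι → E → N
  isOpen_dom : ∀ i, IsOpen (dom i)
  iUnion_dom : ⋃ i, dom i = U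
  smooth : ∀ i, ContDiffOn ℝ ∞ (chart i) (dom i)
  submersion : ∀ i, ∀ q ∈ dom i, Function.Surjective (fderiv ℝ (chart i) q)
  compatible : ∀ i j, ∀ q ∈ dom i ∩ dom j, ∃ V : Set E, IsOpen V ∧ q ∈ V ∧ V ⊆ dom i ∩ dom j ∧
    ∀ q₁ ∈ V, ∀ q₂ ∈ V, chart i q₁ = chart i q₂ ↔ chart j q₁ = chart j q₂

namespace SmoothFoliation

variable {E : Type*} [NormedAddCommGroup E] [NormedSpace ℝ E] {U : Set E}
  {N : Type*} [NormedAddCommGroup N] [NormedSpace ℝ N]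

/-- The leaves are invariant under the vector field `X`: it is tangent to them. -/
def IsInvariant (𝓕 : SmoothFoliation U N) (X : E → E) : Prop :=
  ∀ i, ∀ q ∈ 𝓕.dom i, fderiv ℝ (𝓕.chart i) q (X q) = 0

/-- The leaves are normal (transverse, of complementary dimension) to a set `C` with
tangent space `T` at each of its points. -/
def IsNormalTo (𝓕 : SmoothFoliation U N) (C : Set E) (T : Submodule ℝ E) : Prop :=
  ∀ i, ∀ q ∈ 𝓕.dom i ∩ C, IsCompl (LinearMap.ker (fderiv ℝ (𝓕.chart i) q : E →ₗ[ℝ] N)) T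

end SmoothFoliation

end

/-! Suppose dF(X) = O(|ζ|^10) near `p`. Write e_j = a_j^(-1/3), and let F_{h_j} be the derivative of
`F` in h_j. Where ζ_j = 0 the field is |ζ_{1-j}|² ∂/∂I_j (`field_of_zeta_eq_zero`), so there ∂F/∂I_j
vanishes to order 8 in ζ_{1-j} (`iterate_dir_eq_zero`). This persists at nearby collision points, so
it may be differentiated along the collision set.

Now restrict to the plane I_j = s, I_{1-j} = t, L = 0 through a collision point. By the flatness
just obtained, the s³ coefficient of dF(X) reduces modulo t^7 to t² times [s³] ∂F/∂I_j + W(t)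
F_{h_j}|_{s=0}, where s³t² W(t) is the leading part of h_j' (`exists_X_pow_dvd`). The centre-of-mass
relations kill the intermediate powers of t, so W = A_j + 8 e_j κ t⁴ + O(t^5), with A_j =
`leadingCoeff` and κ = `mixedCoeff`, the same κ for both binaries.

The t⁰ part gives ∂_{I_j}⁴F = -6 A_j F_{h_j}; the t⁴ part evaluates ∂_{I_1}⁴∂_{I_2}⁴F. It is
evaluated once for each j, and the A-terms agree, since A_{1-j} does not depend on h_j. Comparing
the two values leaves κ (e_1 F_{h_1} - e_2 F_{h_2}) = 0 (`mixedCoeff_mul_eq`). The energy passes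
this test, its h-derivatives on the collision set being a_j^(1/3)/2. A function with F_{h_k}(p) =
δ_{jk} does not: the bracket is nonzero near `p`, so κ would vanish on the collision set near `p`.
But κ is a positive multiple of a quadratic form in each of two rotating axes, with double trace
proportional to Δ²(1/|x|) in the plane, which is nonzero (`not_eventually_mixedCoeff_eq_zero`).

A normal invariant foliation reduces to this: a suitable linear functional of a local chart is an
exact first integral with prescribed h-derivatives (`exists_clm_apply_dirH`). -/

noncomputable section

/-! ### Formal Taylor series along a derivation -/

section TaylorHom

open PowerSeries

variable {A R : Type*} [CommRing A] [Algebra ℝ A] [CommRing R] [Algebra ℝ R]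

/-- The formal Taylor series `∑ Dⁿ a Xⁿ / n!`. -/
def expSeries (D : Derivation ℝ A A) (a : A) : A⟦X⟧ :=
  PowerSeries.mk fun n => ((n.factorial : ℝ)⁻¹) • (D : A →ₗ[ℝ] A)^[n] a

theorem coeff_expSeries (D : Derivation ℝ A A) (a : A) (n : ℕ) :
    coeff n (expSeries D a) = ((n.factorial : ℝ)⁻¹) • D^[n] a := by
  simp [expSeries]

theorem succ_smul_coeff_expSeries (D : Derivation ℝ A A) (a : A) (n : ℕ) :
    ((n : ℝ) + 1) • coeff (n + 1) (expSeries D a) = coeff n (expSeries D (D a)) := by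
  rw [coeff_expSeries, coeff_expSeries, Function.iterate_succ_apply, smul_smul, Nat.factorial_succ]
  congr 1
  push_cast
  field_simp

theorem expSeries_add (D : Derivation ℝ A A) (a b : A) :
    expSeries D (a + b) = expSeries D a + expSeries D b := by
  ext n
  simp [coeff_expSeries]

theorem derivative_expSeries (D : Derivation ℝ A A) (a : A) :
    PowerSeries.derivative A (expSeries D a) = expSeries D (D a) := by
  ext n
  rw [PowerSeries.coeff_derivative, ← succ_smul_coeff_expSeries, Algebra.smul_def, mul_comm]
  simp

/-- Formal differentiation replaces `a` by `D a`, so coefficient n + 1 of either side is governed by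
coefficient n for the pairs (a, D b) and (b, D a). Hence the induction must leave `a` and `b` free.
-/
theorem expSeries_mul (D : Derivation ℝ A A) (a b : A) :
    expSeries D (a * b) = expSeries D a * expSeries D b := by
  ext n
  induction n generalizing a b with
  | zero => simp [coeff_expSeries, coeff_mul]
  | succ n ih =>
    have h : ((n : ℝ) + 1) • coeff (n + 1) (expSeries D (a * b))
        = ((n : ℝ) + 1) • coeff (n + 1) (expSeries D a * expSeries D b) := by
      have h1 : ∀ f : A⟦X⟧, ((n : ℝ) + 1) • coeff (n + 1) f
          = coeff n (PowerSeries.derivative A f) := by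
        intro f
        rw [PowerSeries.coeff_derivative, Algebra.smul_def, mul_comm]
        simp
      rw [h1, h1, derivative_expSeries, Derivation.leibniz, Derivation.leibniz,
        derivative_expSeries, derivative_expSeries, expSeries_add, map_add, map_add,
        smul_eq_mul, smul_eq_mul, smul_eq_mul, smul_eq_mul, ih, ih]
    have h2 : (n : ℝ) + 1 ≠ 0 := by positivity
    simpa [smul_smul, inv_mul_cancel₀ h2] using congrArg (fun z => ((n : ℝ) + 1)⁻¹ • z) h

theorem expSeries_algebraMap (D : Derivation ℝ A A) (c : ℝ) :
    expSeries D (algebraMap ℝ A c) = algebraMap ℝ A⟦X⟧ c := by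
  ext n
  rw [coeff_expSeries]
  cases n with
  | zero => simp [PowerSeries.algebraMap_apply]
  | succ n =>
    rw [Function.iterate_succ_apply, D.map_algebraMap]
    simp [PowerSeries.algebraMap_apply, iterate_map_zero D n]

/-- The Taylor expansion along a derivation, as an algebra homomorphism. -/
def taylorHom (D : Derivation ℝ A A) (ε : A →ₐ[ℝ] R) : A →ₐ[ℝ] R⟦X⟧ :=
  { toFun := fun a => PowerSeries.map (ε : A →+* R) (expSeries D a)
    map_one' := by
      have := expSeries_algebraMap D 1
      simp only [map_one] at this
      simp [this]
    map_mul' := fun a b => by rw [expSeries_mul, map_mul]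
    map_zero' := by
      have := expSeries_algebraMap D 0
      simp only [map_zero] at this
      simp [this]
    map_add' := fun a b => by rw [expSeries_add, map_add]
    commutes' := fun c => by
      ext n
      rw [expSeries_algebraMap]
      simp only [PowerSeries.coeff_map, PowerSeries.algebraMap_apply, coeff_C]
      split_ifs <;> simp }

theorem coeff_taylorHom (D : Derivation ℝ A A) (ε : A →ₐ[ℝ] R) (a : A) (n : ℕ) :
    coeff n (taylorHom D ε a) = ((n.factorial : ℝ)⁻¹) • ε (D^[n] a) := by
  change coeff n (PowerSeries.map (ε : A →+* R) (expSeries D a)) = _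
  rw [PowerSeries.coeff_map, coeff_expSeries]
  simp

end TaylorHom

/-! ### Smooth functions, directional derivations and Taylor series in a plane -/

section Smooth

variable (E : Type*) [NormedAddCommGroup E] [NormedSpace ℝ E]

/-- The algebra of smooth real functions on a normed space. -/
def SmoothFun : Subalgebra ℝ (E → ℝ) where
  carrier := {f | ContDiff ℝ ∞ f}
  mul_mem' := fun {a b} (ha : ContDiff ℝ ∞ a) (hb : ContDiff ℝ ∞ b) => ha.mul hb
  add_mem' := fun {a b} (ha : ContDiff ℝ ∞ a) (hb : ContDiff ℝ ∞ b) => ha.add hb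
  algebraMap_mem' := fun c => (contDiff_const : ContDiff ℝ ∞ fun _ : E => c)

variable {E}

namespace SmoothFun

instance : CoeFun (SmoothFun E) (fun _ => E → ℝ) := ⟨fun f => f.1⟩

theorem contDiff (f : SmoothFun E) : ContDiff ℝ ∞ f := f.2

theorem differentiable (f : SmoothFun E) : Differentiable ℝ f :=
  (contDiff f).differentiable (by simp)

@[simp] theorem add_apply (f g : SmoothFun E) (q : E) : (f + g) q = f q + g q := rfl
@[simp] theorem mul_apply (f g : SmoothFun E) (q : E) : (f * g) q = f q * g q := rfl
@[simp] theorem sub_apply (f g : SmoothFun E) (q : E) : (f - g) q = f q - g q := rfl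
@[simp] theorem neg_apply (f : SmoothFun E) (q : E) : (-f) q = -f q := rfl
@[simp] theorem one_apply (q : E) : (1 : SmoothFun E) q = 1 := rfl
@[simp] theorem pow_apply (f : SmoothFun E) (n : ℕ) (q : E) : (f ^ n) q = f q ^ n := rfl
@[simp] theorem algebraMap_apply' (c : ℝ) (q : E) : (algebraMap ℝ (SmoothFun E) c) q = c := rfl

theorem ext {f g : SmoothFun E} (h : ∀ q, f q = g q) : f = g := Subtype.ext (funext h)

/-- Evaluation at a point. -/
def eval (o : E) : SmoothFun E →ₐ[ℝ] ℝ :=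
  (Pi.evalAlgHom ℝ (fun _ : E => ℝ) o).comp (SmoothFun E).val

@[simp] theorem eval_apply (o : E) (f : SmoothFun E) : eval o f = f o := rfl

/-- The directional derivative. -/
def dir (v : E) : Derivation ℝ (SmoothFun E) (SmoothFun E) :=
  Derivation.mk'
    { toFun := fun f => ⟨fun q => fderiv ℝ f q v,
        ((contDiff f).fderiv_right (m := ∞) (by simp)).clm_apply contDiff_const⟩
      map_add' := fun f g => by
        apply ext; intro q
        change fderiv ℝ ((f : E → ℝ) + (g : E → ℝ)) q v = _
        rw [fderiv_add (differentiable f q) (differentiable g q)]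
        rfl
      map_smul' := fun c f => by
        apply ext; intro q
        change fderiv ℝ (c • (f : E → ℝ)) q v = _
        rw [fderiv_const_smul (differentiable f q)]
        rfl }
    (fun f g => by
      apply ext; intro q
      change fderiv ℝ ((f : E → ℝ) * (g : E → ℝ)) q v
        = f q * fderiv ℝ g.1 q v + g q * fderiv ℝ f.1 q v
      rw [fderiv_mul (differentiable f q) (differentiable g q)]
      simp)

theorem dir_apply (v : E) (f : SmoothFun E) (q : E) : dir v f q = fderiv ℝ f q v := rfl

theorem dir_comm (v w : E) (f : SmoothFun E) : dir v (dir w f) = dir w (dir v f) := by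
  apply ext; intro q
  have key : ∀ a b : E, dir a (dir b f) q = fderiv ℝ (fderiv ℝ f) q a b := by
    intro a b
    rw [dir_apply]
    change fderiv ℝ (fun q => fderiv ℝ f q b) q a = _
    have hd : DifferentiableAt ℝ (fderiv ℝ f) q :=
      ((contDiff f).fderiv_right (m := ∞) (by simp)).differentiable (by simp) q
    rw [fderiv_clm_apply hd (differentiableAt_const b)]
    simp
  rw [key, key]
  exact ((contDiff f).contDiffAt.isSymmSndFDerivAt
    (by
      simp only [minSmoothness_of_isRCLikeNormedField]
      exact WithTop.coe_le_coe.2 (le_top : (2 : ℕ∞) ≤ ⊤))).eq v w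

theorem dir_iterate_comm (v w : E) (f : SmoothFun E) (n : ℕ) :
    dir v ((dir w)^[n] f) = (dir w)^[n] (dir v f) := by
  induction n generalizing f with
  | zero => rfl
  | succ n ih => rw [Function.iterate_succ_apply, ih, dir_comm, Function.iterate_succ_apply]

theorem dir_add (v w : E) (f : SmoothFun E) : dir (v + w) f = dir v f + dir w f := by
  apply ext; intro q; simp [dir_apply]

theorem dir_smul (c : ℝ) (w : E) (f : SmoothFun E) : dir (c • w) f = c • dir w f := by
  apply ext; intro q; simp [dir_apply]

/-- Multiplication by a bump function makes a local function global without changing its germ at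
`p`. All later computations can then take place in one algebra, with globally defined derivations.
-/
theorem exists_eventuallyEq [FiniteDimensional ℝ E] {φ : E → ℝ} {V : Set E} {p : E}
    (hφ : ContDiffOn ℝ ∞ φ V) (hV : V ∈ 𝓝 p) : ∃ f : SmoothFun E, f =ᶠ[𝓝 p] φ := by
  obtain ⟨r, hr, hrV⟩ := Metric.mem_nhds_iff.1 hV
  let χ : ContDiffBump p := ⟨r / 4, r / 2, by positivity, by linarith⟩
  have hin : ∀ q, q ∈ tsupport χ → ContDiffAt ℝ ∞ φ q := by
    intro q hq
    rw [χ.tsupport_eq] at hq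
    have h2 : q ∈ Metric.ball p r :=
      Metric.closedBall_subset_ball (by change r / 2 < r; linarith) hq
    exact hφ.contDiffAt (Filter.mem_of_superset (Metric.isOpen_ball.mem_nhds h2) hrV)
  refine ⟨⟨fun q => χ q * φ q, ?_⟩, ?_⟩
  · change ContDiff ℝ ∞ fun q => χ q * φ q
    refine contDiff_iff_contDiffAt.2 fun q => ?_
    by_cases hq : q ∈ tsupport χ
    · exact χ.contDiff.contDiffAt.mul (hin q hq)
    · refine (contDiffAt_const : ContDiffAt ℝ ∞ (fun _ : E => (0 : ℝ)) q).congr_of_eventuallyEq ?_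
      have := notMem_tsupport_iff_eventuallyEq.1 hq
      filter_upwards [this] with y hy
      simp [hy]
  · filter_upwards [χ.eventuallyEq_one] with q hq
    simp [hq]

/-- Restriction to the parametrised plane `o + s v + t w`. -/
def res (o v w : E) : SmoothFun E →ₐ[ℝ] SmoothFun (ℝ × ℝ) :=
  { toFun := fun f => ⟨fun q => f (o + q.1 • v + q.2 • w), (contDiff f).comp (by fun_prop)⟩
    map_one' := rfl
    map_mul' := fun _ _ => rfl
    map_zero' := rfl
    map_add' := fun _ _ => rfl
    commutes' := fun _ => rfl }

theorem res_apply (o v w : E) (f : SmoothFun E) (q : ℝ × ℝ) :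
    res o v w f q = f (o + q.1 • v + q.2 • w) := rfl

theorem dir_res (o v w : E) (f : SmoothFun E) (a b : ℝ) :
    dir (a, b) (res o v w f) = res o v w (dir (a • v + b • w) f) := by
  apply ext; intro q
  rw [res_apply, dir_apply, dir_apply]
  have h1 : HasFDerivAt (fun q : ℝ × ℝ => o + q.1 • v + q.2 • w)
      ((ContinuousLinearMap.fst ℝ ℝ ℝ).smulRight v + (ContinuousLinearMap.snd ℝ ℝ ℝ).smulRight w)
      q :=
    (((ContinuousLinearMap.fst ℝ ℝ ℝ).smulRight v).hasFDerivAt.const_add o).add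
      ((ContinuousLinearMap.snd ℝ ℝ ℝ).smulRight w).hasFDerivAt
  have h2 := ((differentiable f _).hasFDerivAt).comp q h1
  have h3 : fderiv ℝ (res o v w f) q = _ := h2.fderiv
  rw [h3]
  simp

theorem dir_fst_res (o v w : E) (f : SmoothFun E) :
    dir (1, 0) (res o v w f) = res o v w (dir v f) := by
  rw [dir_res]; simp

theorem dir_snd_res (o v w : E) (f : SmoothFun E) :
    dir (0, 1) (res o v w f) = res o v w (dir w f) := by
  rw [dir_res]; simp

/-- The coordinates on the plane. -/
def fst : SmoothFun (ℝ × ℝ) := ⟨fun q => q.1, (contDiff_fst : ContDiff ℝ ∞ fun q : ℝ × ℝ => q.1)⟩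
def snd : SmoothFun (ℝ × ℝ) := ⟨fun q => q.2, (contDiff_snd : ContDiff ℝ ∞ fun q : ℝ × ℝ => q.2)⟩

@[simp] theorem fst_apply (q : ℝ × ℝ) : fst q = q.1 := rfl
@[simp] theorem snd_apply (q : ℝ × ℝ) : snd q = q.2 := rfl

open PowerSeries

/-- The Taylor series at the origin of the plane, as a series in the first variable with
coefficients series in the second. -/
def taylor : SmoothFun (ℝ × ℝ) →ₐ[ℝ] ℝ⟦X⟧⟦X⟧ :=
  taylorHom (dir (1, 0)) (taylorHom (dir (0, 1)) (eval 0))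

theorem coeff_taylor (f : SmoothFun (ℝ × ℝ)) (i j : ℕ) :
    coeff j (coeff i (taylor f)) = ((i.factorial : ℝ)⁻¹) * ((j.factorial : ℝ)⁻¹) *
      ((dir (0, 1))^[j] ((dir (1, 0))^[i] f)) 0 := by
  rw [taylor, coeff_taylorHom, coeff_smul, coeff_taylorHom]
  simp [mul_assoc]

theorem coeff_taylor_res {o v w : E} (f : SmoothFun E) (i j : ℕ) :
    coeff j (coeff i (taylor (res o v w f))) = ((i.factorial : ℝ)⁻¹) * ((j.factorial : ℝ)⁻¹) *
      ((dir w)^[j] ((dir v)^[i] f)) o := by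
  have h1 : ∀ n (f : SmoothFun E), (dir (1, 0))^[n] (res o v w f) = res o v w ((dir v)^[n] f) := by
    intro n
    induction n with
    | zero => intro f; rfl
    | succ n ih => intro f; rw [Function.iterate_succ_apply, dir_fst_res, ih]; rfl
  have h2 : ∀ n (f : SmoothFun E), (dir (0, 1))^[n] (res o v w f) = res o v w ((dir w)^[n] f) := by
    intro n
    induction n with
    | zero => intro f; rfl
    | succ n ih => intro f; rw [Function.iterate_succ_apply, dir_snd_res, ih]; rfl
  rw [coeff_taylor, h1, h2, res_apply]
  simp

theorem taylor_fst : taylor fst = X := by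
  have h1 : dir (1, 0) fst = 1 := by
    apply ext; intro q
    rw [dir_apply]
    change fderiv ℝ (fun q : ℝ × ℝ => q.1) q (1, 0) = 1
    simp [fderiv_fst]
  have h0 : dir (0, 1) fst = 0 := by
    apply ext; intro q
    rw [dir_apply]
    change fderiv ℝ (fun q : ℝ × ℝ => q.1) q (0, 1) = 0
    simp [fderiv_fst]
  have h2 : dir (1, 0) (1 : SmoothFun (ℝ × ℝ)) = 0 := Derivation.map_one_eq_zero _
  have h3 : dir (0, 1) (1 : SmoothFun (ℝ × ℝ)) = 0 := Derivation.map_one_eq_zero _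
  ext i j
  rw [coeff_taylor, coeff_X]
  rcases i with _ | _ | i <;> rcases j with _ | j <;>
    simp [h0, h1, h2, h3, iterate_map_zero, coeff_one]

theorem taylor_snd : taylor snd = C X := by
  have h1 : dir (0, 1) snd = 1 := by
    apply ext; intro q
    rw [dir_apply]
    change fderiv ℝ (fun q : ℝ × ℝ => q.2) q (0, 1) = 1
    simp [fderiv_snd]
  have h0 : dir (1, 0) snd = 0 := by
    apply ext; intro q
    rw [dir_apply]
    change fderiv ℝ (fun q : ℝ × ℝ => q.2) q (1, 0) = 0
    simp [fderiv_snd]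
  have h3 : dir (0, 1) (1 : SmoothFun (ℝ × ℝ)) = 0 := Derivation.map_one_eq_zero _
  ext i j
  rw [coeff_taylor, coeff_C]
  rcases i with _ | i <;> rcases j with _ | _ | j <;>
    simp [h0, h1, h3, iterate_map_zero, coeff_X]

theorem iteratedDeriv_line (o v : E) (f : SmoothFun E) (n : ℕ) (r : ℝ) :
    iteratedDeriv n (fun r : ℝ => f (o + r • v)) r = ((dir v)^[n] f) (o + r • v) := by
  induction n generalizing r with
  | zero => simp
  | succ n ih =>
    rw [iteratedDeriv_succ, funext ih, Function.iterate_succ_apply', dir_apply]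
    have h1 : HasDerivAt (fun r : ℝ => o + r • v) v r := by
      simpa using ((hasDerivAt_id r).smul_const v).const_add o
    exact ((differentiable ((dir v)^[n] f) _).hasFDerivAt.comp_hasDerivAt r h1).deriv

end SmoothFun
end Smooth

/-! ### Order of vanishing and Taylor coefficients -/

theorem iteratedDeriv_eq_zero_of_isBigO {g : ℝ → ℝ} (hg : ContDiff ℝ ∞ g) {N : ℕ}
    (hO : g =O[𝓝[≠] 0] fun r => r ^ N) : ∀ k < N, iteratedDeriv k g 0 = 0 := by
  intro k
  induction k using Nat.strong_induction_on with
  | _ k ih =>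
    intro hk
    have ht := taylor_isLittleO_univ (x₀ := (0 : ℝ)) (n := k)
      (hg.of_le (by exact_mod_cast le_top))
    -- By strong induction the degree `k` Taylor polynomial is a single monomial. It is o(x^k)
    -- because `g` is, so its coefficient must vanish.
    have hP : ∀ x, taylorWithinEval g k Set.univ 0 x
        = ((k.factorial : ℝ)⁻¹ * iteratedDeriv k g 0) * x ^ k := by
      intro x
      rw [taylor_within_apply, Finset.sum_range_succ, Finset.sum_eq_zero]
      · simp [iteratedDerivWithin_univ]; ring
      · intro i hi
        rw [iteratedDerivWithin_univ, ih i (Finset.mem_range.1 hi)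
          ((Finset.mem_range.1 hi).trans hk)]
        simp
    have h1 : (fun x : ℝ => ((k.factorial : ℝ)⁻¹ * iteratedDeriv k g 0) * x ^ k)
        =o[𝓝[≠] 0] fun x => x ^ k := by
      have h2 : g =o[𝓝[≠] 0] fun x : ℝ => x ^ k :=
        hO.trans_isLittleO ((Asymptotics.isLittleO_pow_pow hk).mono nhdsWithin_le_nhds)
      have h3 := h2.sub (ht.mono nhdsWithin_le_nhds |>.congr_right (g₂ := fun x => x ^ k) (by simp))
      refine h3.congr_left fun x => ?_
      rw [hP]; ring
    have h4 := Asymptotics.isLittleO_iff.1 h1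
    by_contra hne
    set c := (k.factorial : ℝ)⁻¹ * iteratedDeriv k g 0 with hc
    have hc0 : c ≠ 0 := mul_ne_zero (by positivity) hne
    have h5 := h4 (c := |c| / 2) (by positivity)
    obtain ⟨x, hx, hx0⟩ := (h5.and self_mem_nhdsWithin).exists
    rw [norm_mul, Real.norm_eq_abs] at hx
    have hpos : 0 < ‖x ^ k‖ := norm_pos_iff.2 (pow_ne_zero _ hx0)
    have := abs_pos.2 hc0
    nlinarith

namespace SmoothFun

open PowerSeries

/-- Restriction to lines through the origin reduces to one variable. The derivative of order i + j
along (1, α) is a polynomial in α whose coefficients are the mixed partials times binomial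
coefficients; it vanishes for all α, so each mixed partial does. The punctured neighbourhood allows
bounds obtained by dividing by a factor that vanishes at the origin. -/
theorem coeff_taylor_eq_zero_of_isBigO {f : SmoothFun (ℝ × ℝ)} {N : ℕ}
    (hf : f =O[𝓝[≠] 0] fun q => ‖q‖ ^ N) {i j : ℕ} (hij : i + j < N) :
    coeff j (coeff i (taylor f)) = 0 := by
  have hline : ∀ v : ℝ × ℝ, v ≠ 0 → ((dir v)^[i + j] f) 0 = 0 := by
    intro v hv
    have h := iteratedDeriv_line (0 : ℝ × ℝ) v f (i + j) 0
    simp only [zero_smul, add_zero, zero_add] at h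
    rw [← h]
    refine iteratedDeriv_eq_zero_of_isBigO ((contDiff f).comp (by fun_prop)) ?_ _ hij
    have ht : Filter.Tendsto (fun r : ℝ => r • v) (𝓝[≠] 0) (𝓝[≠] 0) := by
      refine tendsto_nhdsWithin_iff.2 ⟨?_, ?_⟩
      · have : Continuous fun r : ℝ => r • v := by fun_prop
        simpa using (this.tendsto 0).mono_left nhdsWithin_le_nhds
      · filter_upwards [self_mem_nhdsWithin] with r hr
        exact smul_ne_zero hr hv
    refine (hf.comp_tendsto ht).trans ?_
    refine Asymptotics.IsBigO.of_bound (‖v‖ ^ N) (Filter.Eventually.of_forall fun r => ?_)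
    simp [norm_smul, mul_pow, mul_comm]
  have hpoly : ∀ α : ℝ, ((dir ((1 : ℝ), α))^[i + j] f) 0 = ∑ k ∈ Finset.range (i + j + 1),
      (((i + j).choose k : ℝ) * ((dir (0, 1))^[i + j - k] ((dir (1, 0))^[k] f)) 0) *
        α ^ (i + j - k) := by
    intro α
    let D₁ : Module.End ℝ (SmoothFun (ℝ × ℝ)) := (dir (1, 0)).toLinearMap
    let D₂ : Module.End ℝ (SmoothFun (ℝ × ℝ)) := (dir (0, 1)).toLinearMap
    have hcomm : Commute D₁ (α • D₂) := by
      refine Commute.smul_right ?_ α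
      exact LinearMap.ext fun g => dir_comm _ _ g
    have hD : (dir ((1 : ℝ), α)).toLinearMap = D₁ + α • D₂ := by
      refine LinearMap.ext fun g => ?_
      have : ((1 : ℝ), α) = (1, 0) + α • ((0 : ℝ), (1 : ℝ)) := by simp
      change dir ((1 : ℝ), α) g = dir (1, 0) g + α • dir (0, 1) g
      rw [this, dir_add, dir_smul]
    have h1 : (dir ((1 : ℝ), α))^[i + j] f = ((D₁ + α • D₂) ^ (i + j)) f := by
      rw [← hD, Module.End.pow_apply]; rfl
    have hswap : ∀ a b, D₁ ^ a * D₂ ^ b = D₂ ^ b * D₁ ^ a := fun a b =>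
      ((show Commute D₁ D₂ from LinearMap.ext fun g => dir_comm _ _ g).pow_pow a b)
    rw [h1, hcomm.add_pow, LinearMap.sum_apply, ← eval_apply, map_sum]
    refine Finset.sum_congr rfl fun k _ => ?_
    have h2 : (D₁ ^ k * (α • D₂) ^ (i + j - k) *
        (((i + j).choose k : ℕ) : Module.End ℝ (SmoothFun (ℝ × ℝ)))) f
        = (α ^ (i + j - k) * (i + j).choose k) •
          ((dir (0, 1))^[i + j - k] ((dir (1, 0))^[k] f)) := by
      rw [smul_pow, mul_smul_comm, hswap]
      have h3 : ((dir (0, 1))^[i + j - k] ((dir (1, 0))^[k] f))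
          = (D₂ ^ (i + j - k) * D₁ ^ k) f := by
        rw [Module.End.mul_apply, Module.End.pow_apply, Module.End.pow_apply]; rfl
      rw [h3, ← nsmul_eq_mul']
      simp only [LinearMap.smul_apply, mul_smul]
      rw [smul_comm, Nat.cast_smul_eq_nsmul ℝ]
    rw [h2, map_smul, eval_apply, smul_eq_mul]
    ring
  let P : Polynomial ℝ := ∑ k ∈ Finset.range (i + j + 1),
      Polynomial.monomial (i + j - k)
        (((i + j).choose k : ℝ) * ((dir (0, 1))^[i + j - k] ((dir (1, 0))^[k] f)) 0)
  have hP : P = 0 := by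
    refine Polynomial.funext fun α => ?_
    rw [Polynomial.eval_finsetSum]
    simp only [Polynomial.eval_monomial, Polynomial.eval_zero]
    rw [← hpoly, hline _ (by simp)]
  have hc : P.coeff j = ((i + j).choose i : ℝ) * ((dir (0, 1))^[j] ((dir (1, 0))^[i] f)) 0 := by
    simp only [P, Polynomial.finsetSum_coeff, Polynomial.coeff_monomial]
    rw [Finset.sum_eq_single i]
    · simp
    · intro k hk hki
      have := Finset.mem_range.1 hk
      rw [if_neg (by omega)]
    · intro h
      exact absurd (Finset.mem_range.2 (by omega)) h
  rw [hP, Polynomial.coeff_zero] at hc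
  have hch : ((i + j).choose i : ℝ) ≠ 0 := by
    exact_mod_cast (Nat.choose_pos (Nat.le_add_right i j)).ne'
  rw [coeff_taylor, (mul_eq_zero.1 hc.symm).resolve_left hch, mul_zero]

end SmoothFun

/-! ### Series in `s` (outer variable) with coefficients series in `t` (inner variable) -/

section PowerSeriesAlgebra

open PowerSeries

section General

variable {R : Type*} [CommRing R]

theorem coeff_zero_mul' (f g : R⟦X⟧) : coeff 0 (f * g) = coeff 0 f * coeff 0 g := by
  simp [coeff_mul]

theorem coeff_one_mul' (f g : R⟦X⟧) :
    coeff 1 (f * g) = coeff 0 f * coeff 1 g + coeff 1 f * coeff 0 g := by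
  simp [coeff_mul, Finset.Nat.antidiagonal_succ]

theorem coeff_two_mul' (f g : R⟦X⟧) :
    coeff 2 (f * g) = coeff 0 f * coeff 2 g + coeff 1 f * coeff 1 g + coeff 2 f * coeff 0 g := by
  simp [coeff_mul, Finset.Nat.antidiagonal_succ]; ring

/-- The derivative of a function along the rescaled field, at the point with coordinates `s`, `t`
in the plane of radial variables. -/
def transport (s t B B' l l' β η' ϑ ϑ' cr ci F1 F2 FL FL' Fh Fh' Fθ Fθ' Fx Fr Fi : R) : R :=
  t ^ 2 * (1 + s ^ 2 * B) * F1 + s ^ 2 * (1 + t ^ 2 * B') * F2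
    + s ^ 4 * t ^ 2 * l * FL + s ^ 2 * t ^ 2 * l' * FL'
    + s * t ^ 2 * β * Fh + s ^ 2 * η' * Fh'
    + s ^ 3 * t ^ 2 * ϑ * Fθ + s ^ 2 * t ^ 2 * ϑ' * Fθ'
    + s ^ 2 * t ^ 2 * Fx + s ^ 2 * t ^ 2 * (cr * Fr + ci * Fi)

variable (t : R) (B B' l l' β η' ϑ ϑ' cr ci F1 F2 FL FL' Fh Fh' Fθ Fθ' Fx Fr Fi : R⟦X⟧)

theorem coeff_one_transport (hβ0 : coeff 0 β = 0) :
    coeff 1 (transport X (C t) B B' l l' β η' ϑ ϑ' cr ci F1 F2 FL FL' Fh Fh' Fθ Fθ' Fx Fr Fi)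
      = t ^ 2 * coeff 1 F1 := by
  simp only [transport, ← map_pow, mul_assoc, map_add, coeff_C_mul, coeff_X_pow_mul', add_mul,
    mul_add, one_mul]
  rw [show (X : R⟦X⟧) * (C (t ^ 2) * (β * Fh)) = X ^ 1 * (C (t ^ 2) * (β * Fh)) by ring]
  simp only [coeff_C_mul, coeff_X_pow_mul']
  simp [coeff_zero_mul', hβ0]

/-- The L_j term carries s⁴, and the θ_j term carries s³ times a series without constant term, so
neither reaches s³. The h_j term contributes only through the s² coefficient of `β`. The remaining
coefficients have no linear part, so they meet only the linear parts of the derivatives of `F`. -/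
theorem coeff_three_transport (hβ0 : coeff 0 β = 0) (hβ1 : coeff 1 β = 0)
    (hϑ : coeff 0 ϑ = 0) (hB' : coeff 1 B' = 0) (hl' : coeff 1 l' = 0) (hη' : coeff 1 η' = 0)
    (hϑ' : coeff 1 ϑ' = 0) (hcr : coeff 1 cr = 0) (hci : coeff 1 ci = 0) :
    coeff 3 (transport X (C t) B B' l l' β η' ϑ ϑ' cr ci F1 F2 FL FL' Fh Fh' Fθ Fθ' Fx Fr Fi)
      = t ^ 2 * (coeff 3 F1 + coeff 2 β * coeff 0 Fh)
        + t ^ 2 * (coeff 0 B * coeff 1 F1 + coeff 1 B * coeff 0 F1)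
        + (1 + t ^ 2 * coeff 0 B') * coeff 1 F2 + t ^ 2 * (coeff 0 l' * coeff 1 FL')
        + coeff 0 η' * coeff 1 Fh' + t ^ 2 * (coeff 0 ϑ' * coeff 1 Fθ' + coeff 1 Fx
          + (coeff 0 cr * coeff 1 Fr + coeff 0 ci * coeff 1 Fi)) := by
  simp only [transport, ← map_pow, mul_assoc, map_add, coeff_C_mul, coeff_X_pow_mul', add_mul,
    mul_add, one_mul]
  rw [show (X : R⟦X⟧) * (C (t ^ 2) * (β * Fh)) = X ^ 1 * (C (t ^ 2) * (β * Fh)) by ring]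
  simp [coeff_zero_mul', coeff_one_mul', coeff_two_mul', hβ0, hβ1, hϑ, hB', hl', hη', hϑ', hcr, hci]
  ring

end General

/-- Vanishing in total degree below 10 controls the s³ coefficient modulo t^7, as 3 + 6 = 9. Modulo
t^7 the unwanted terms vanish: t² times the s-linear part of `F1` by the s¹ coefficient of the same
identity, the others by hypothesis. Cancelling t² leaves t^5, just enough to see t⁴. -/
theorem X_pow_dvd_transport {t : ℝ⟦X⟧} (ht : t = X)
    {B B' l l' β η' ϑ ϑ' cr ci F1 F2 FL FL' Fh Fh' Fθ Fθ' Fx Fr Fi : ℝ⟦X⟧⟦X⟧}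
    (hβ0 : coeff 0 β = 0) (hβ1 : coeff 1 β = 0)
    (hϑ : coeff 0 ϑ = 0) (hB' : coeff 1 B' = 0) (hl' : coeff 1 l' = 0) (hη' : coeff 1 η' = 0)
    (hϑ' : coeff 1 ϑ' = 0) (hcr : coeff 1 cr = 0) (hci : coeff 1 ci = 0)
    (hF10 : X ^ 7 ∣ coeff 0 F1) (hF2 : X ^ 7 ∣ coeff 1 F2) (hL' : X ^ 7 ∣ coeff 1 FL')
    (hh' : X ^ 7 ∣ coeff 1 Fh') (hθ' : X ^ 7 ∣ coeff 1 Fθ') (hx : X ^ 7 ∣ coeff 1 Fx)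
    (hr : X ^ 7 ∣ coeff 1 Fr) (hi : X ^ 7 ∣ coeff 1 Fi)
    (hΦ : ∀ i j, i + j < 10 → coeff j (coeff i (transport X (C t) B B' l l' β η' ϑ ϑ' cr ci
      F1 F2 FL FL' Fh Fh' Fθ Fθ' Fx Fr Fi)) = 0) :
    X ^ 5 ∣ coeff 3 F1 + coeff 2 β * coeff 0 Fh := by
  subst ht
  have h1 : (X : ℝ⟦X⟧) ^ 7 ∣ X ^ 2 * coeff 1 F1 := by
    rw [← coeff_one_transport X B B' l l' β η' ϑ ϑ' cr ci F1 F2 FL FL' Fh Fh' Fθ Fθ' Fx Fr Fi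
      hβ0]
    exact X_pow_dvd_iff.2 fun m hm => hΦ 1 m (by omega)
  have h3 := (X_pow_dvd_iff (R := ℝ) (n := 7)).2 fun m hm => hΦ 3 m (by omega)
  rw [coeff_three_transport X B B' l l' β η' ϑ ϑ' cr ci F1 F2 FL FL' Fh Fh' Fθ Fθ' Fx Fr Fi
    hβ0 hβ1 hϑ hB' hl' hη' hϑ' hcr hci] at h3
  have key : (X : ℝ⟦X⟧) ^ 7 ∣ X ^ 2 * (coeff 3 F1 + coeff 2 β * coeff 0 Fh) := by
    obtain ⟨a0, h1⟩ := h1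
    obtain ⟨a1, hF10⟩ := hF10
    obtain ⟨a2, hF2⟩ := hF2
    obtain ⟨a3, hL'⟩ := hL'
    obtain ⟨a4, hh'⟩ := hh'
    obtain ⟨a5, hθ'⟩ := hθ'
    obtain ⟨a6, hx⟩ := hx
    obtain ⟨a7, hr⟩ := hr
    obtain ⟨a8, hi⟩ := hi
    obtain ⟨a9, h3⟩ := h3
    rw [hF10, hF2, hL', hh', hθ', hx, hr, hi] at h3
    refine ⟨a9 - coeff 0 B * a0 - X ^ 2 * (coeff 1 B * a1) - (1 + X ^ 2 * coeff 0 B') * a2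
      - X ^ 2 * (coeff 0 l' * a3) - coeff 0 η' * a4 - X ^ 2 * (coeff 0 ϑ' * a5 + a6
          + (coeff 0 cr * a7 + coeff 0 ci * a8)), ?_⟩
    linear_combination h3 - coeff 0 B * h1
  rw [show (X : ℝ⟦X⟧) ^ 7 = X ^ 2 * X ^ 5 by ring] at key
  exact (mul_dvd_mul_iff_left (pow_ne_zero 2 X_ne_zero)).1 key

section Quadratic

theorem two_ne_zero_powerSeries : (2 : ℝ⟦X⟧) ≠ 0 := by
  rw [← map_ofNat (C (R := ℝ)) 2]
  exact fun h => two_ne_zero (C_injective (h.trans (map_zero C).symm))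

/-- The constant part is idempotent in a domain and nonzero, hence 1; the linear part then satisfies
2v - v = 0. This serves for U_j², which depends on s² only. -/
theorem coeff_of_sq_sub_self {V : ℝ⟦X⟧⟦X⟧} {c : ℝ⟦X⟧} (hV : V ^ 2 - V = C c * X ^ 2)
    (h0 : coeff 0 (coeff 0 V) = 1) : coeff 0 V = 1 ∧ coeff 1 V = 0 := by
  have e0 := congrArg (coeff 0) hV
  have e1 := congrArg (coeff 1) hV
  simp only [map_sub, pow_two V, coeff_zero_mul', coeff_one_mul', coeff_C_mul, coeff_X_pow] at e0 e1
  norm_num at e0 e1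
  have hne : coeff 0 V ≠ 0 := by
    intro h; rw [h] at h0; simp at h0
  have hV0 : coeff 0 V = 1 := by
    apply mul_left_cancel₀ hne
    simp only [coeff_zero_eq_constantCoeff] at e0 ⊢
    linear_combination e0
  refine ⟨hV0, ?_⟩
  simp only [coeff_zero_eq_constantCoeff] at e1 hV0
  rw [hV0] at e1
  linear_combination e1

/-- The counterpart for U_{1-j}², which does not depend on `s`: each coefficient is multiplied by
2V₀ - 1, whose constant term is 1, so it must be zero. -/
theorem coeff_of_sq_sub_self_C {V : ℝ⟦X⟧⟦X⟧} {c : ℝ⟦X⟧} (hV : V ^ 2 - V = C c)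
    (h0 : coeff 0 (coeff 0 V) = 1) : coeff 1 V = 0 ∧ coeff 2 V = 0 := by
  have e1 := congrArg (coeff 1) hV
  have e2 := congrArg (coeff 2) hV
  simp only [map_sub, pow_two V, coeff_one_mul', coeff_two_mul', coeff_C, one_ne_zero, if_false,
    OfNat.ofNat_ne_zero] at e1 e2
  have h2 : (2 * coeff 0 V - 1) ≠ 0 := by
    intro h
    have h' := congrArg (coeff 0) h
    rw [map_sub, two_mul, map_add, h0] at h'
    simp at h'
  have h1 : coeff 1 V = 0 :=
    (mul_eq_zero.1 (by linear_combination e1 : (2 * coeff 0 V - 1) * coeff 1 V = 0)).resolve_left h2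
  refine ⟨h1, (mul_eq_zero.1 (?_ : (2 * coeff 0 V - 1) * coeff 2 V = 0)).resolve_left h2⟩
  rw [h1] at e2
  linear_combination e2

theorem coeff_one_of_mul_eq_one {V Y : ℝ⟦X⟧⟦X⟧} (h : V * Y = 1) (h1 : coeff 1 V = 0) :
    coeff 1 Y = 0 := by
  have e0 := congrArg (coeff 0) h
  have e1 := congrArg (coeff 1) h
  rw [coeff_zero_mul'] at e0
  rw [coeff_one_mul', h1] at e1
  simp only [coeff_one, if_true, one_ne_zero, if_false] at e0 e1
  linear_combination coeff 0 Y * e1 - coeff 1 Y * e0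

theorem coeff_two_of_mul_eq_one {V Y : ℝ⟦X⟧⟦X⟧} (h : V * Y = 1) (h1 : coeff 1 V = 0)
    (h2 : coeff 2 V = 0) : coeff 2 Y = 0 := by
  have e0 := congrArg (coeff 0) h
  have e2 := congrArg (coeff 2) h
  rw [coeff_zero_mul'] at e0
  rw [coeff_two_mul', h1, h2] at e2
  simp only [coeff_one, if_true, OfNat.ofNat_ne_zero, if_false] at e0 e2
  linear_combination coeff 0 Y * e2 - coeff 2 Y * e0

theorem coeff_one_of_sq_mul_eq_one {ψ D : ℝ⟦X⟧⟦X⟧} (h : ψ ^ 2 * D = 1) (h1 : coeff 1 D = 0) :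
    coeff 1 ψ = 0 ∧ coeff 2 ψ = - C (1 / 2) * coeff 0 ψ ^ 3 * coeff 2 D := by
  have e0 := congrArg (coeff 0) h
  have e1 := congrArg (coeff 1) h
  have e2 := congrArg (coeff 2) h
  simp only [pow_two ψ, coeff_zero_mul', coeff_one_mul', coeff_two_mul', h1, coeff_one] at e0 e1 e2
  simp only [if_true, one_ne_zero, if_false, OfNat.ofNat_ne_zero] at e0 e1 e2
  have hψ : coeff 1 ψ = 0 := by
    have h2 : (2 : ℝ⟦X⟧) * coeff 1 ψ = 0 := by
      linear_combination coeff 0 ψ * e1 - 2 * coeff 1 ψ * e0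
    have h3 : (2 : ℝ⟦X⟧) ≠ 0 := two_ne_zero_powerSeries
    exact (mul_eq_zero.1 h2).resolve_left h3
  refine ⟨hψ, ?_⟩
  rw [hψ] at e2
  have h3 : (2 : ℝ⟦X⟧) * C (1 / 2) = 1 := by
    rw [← map_ofNat (C (R := ℝ)) 2, ← map_mul]; norm_num
  have h2 : (2 : ℝ⟦X⟧) ≠ 0 := two_ne_zero_powerSeries
  apply mul_left_cancel₀ h2
  linear_combination coeff 0 ψ * e2 - 2 * coeff 2 ψ * e0 + coeff 0 ψ ^ 3 * coeff 2 D * h3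

end Quadratic

/-! ### Second-order expansions in τ, modulo the fifth power of the variable -/

section Jets

/-- `f = a + b τ + c τ²` up to order five. -/
def IsJet (τ f : ℝ⟦X⟧) (a b c : ℝ) : Prop := X ^ 5 ∣ f - (C a + C b * τ + C c * τ ^ 2)

variable {τ f g : ℝ⟦X⟧} {a b c a' b' c' : ℝ}

theorem IsJet.mul (hτ : X ^ 2 ∣ τ) (hf : IsJet τ f a b c) (hg : IsJet τ g a' b' c') :
    IsJet τ (f * g) (a * a') (a * b' + b * a') (a * c' + b * b' + c * a') := by
  obtain ⟨u, hu⟩ := hf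
  obtain ⟨v, hv⟩ := hg
  obtain ⟨w, rfl⟩ := hτ
  refine ⟨u * g + (C a + C b * (X ^ 2 * w) + C c * (X ^ 2 * w) ^ 2) * v
    + X * w ^ 3 * (C b * C c' + C c * C b' + C c * C c' * (X ^ 2 * w)), ?_⟩
  simp only [map_add, map_mul]
  linear_combination g * hu + (C a + C b * (X ^ 2 * w) + C c * (X ^ 2 * w) ^ 2) * hv

theorem IsJet.add (hf : IsJet τ f a b c) (hg : IsJet τ g a' b' c') :
    IsJet τ (f + g) (a + a') (b + b') (c + c') := by
  have := dvd_add hf hg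
  unfold IsJet
  convert this using 1
  simp only [map_add]
  ring

theorem isJet_affine (a b : ℝ) : IsJet τ (C a + C b * τ) a b 0 := by simp [IsJet]

theorem IsJet.const_mul (k : ℝ) (hf : IsJet τ f a b c) :
    IsJet τ (C k * f) (k * a) (k * b) (k * c) := by
  have := dvd_mul_of_dvd_right hf (C k)
  unfold IsJet
  convert this using 1
  simp only [map_mul]
  ring

/-- The binomial expansion π of D^(-1/2) satisfies π² D ≡ 1 modulo X^5, so (f - π)(f + π) D ≡ 0. The
last two factors form a unit because `f` and π have the same nonzero constant term. -/
theorem IsJet.inv_sqrt (hτ : X ^ 2 ∣ τ) {r b w : ℝ} (hr : 0 < r)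
    (h : f ^ 2 * (C (r ^ 2) + C (2 * b) * τ + C w * τ ^ 2) = 1) (h0 : coeff 0 f = r⁻¹) :
    IsJet τ f r⁻¹ (- b * r⁻¹ ^ 3) (3 / 2 * b ^ 2 * r⁻¹ ^ 5 - 1 / 2 * w * r⁻¹ ^ 3) := by
  set π : ℝ⟦X⟧ := C r⁻¹ + C (- b * r⁻¹ ^ 3) * τ
    + C (3 / 2 * b ^ 2 * r⁻¹ ^ 5 - 1 / 2 * w * r⁻¹ ^ 3) * τ ^ 2 with hπ
  set D : ℝ⟦X⟧ := C (r ^ 2) + C (2 * b) * τ + C w * τ ^ 2 with hD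
  have hjπ : IsJet τ π r⁻¹ (- b * r⁻¹ ^ 3) (3 / 2 * b ^ 2 * r⁻¹ ^ 5 - 1 / 2 * w * r⁻¹ ^ 3) := by
    simp [IsJet, hπ]
  have hjD : IsJet τ D (r ^ 2) (2 * b) w := by simp [IsJet, hD]
  have hj := ((hjπ.mul hτ hjπ).mul hτ hjD)
  have hr0 := hr.ne'
  have hd : X ^ 5 ∣ π * π * D - 1 := by
    unfold IsJet at hj
    convert hj using 2
    have e1 : r⁻¹ * r⁻¹ * r ^ 2 = 1 := by field_simp
    have e2 : r⁻¹ * r⁻¹ * (2 * b) + (r⁻¹ * (-b * r⁻¹ ^ 3) + -b * r⁻¹ ^ 3 * r⁻¹) * r ^ 2 = 0 := by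
      field_simp; ring
    have e3 : r⁻¹ * r⁻¹ * w + (r⁻¹ * (-b * r⁻¹ ^ 3) + -b * r⁻¹ ^ 3 * r⁻¹) * (2 * b)
      + (r⁻¹ * (3 / 2 * b ^ 2 * r⁻¹ ^ 5 - 1 / 2 * w * r⁻¹ ^ 3) + -b * r⁻¹ ^ 3 * (-b * r⁻¹ ^ 3)
        + (3 / 2 * b ^ 2 * r⁻¹ ^ 5 - 1 / 2 * w * r⁻¹ ^ 3) * r⁻¹) * r ^ 2 = 0 := by
      field_simp; ring
    rw [e1, e2, e3]
    simp
  have hτ0 : constantCoeff τ = 0 := by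
    obtain ⟨w, rfl⟩ := hτ
    simp
  have hunit : IsUnit ((f + π) * D) := by
    rw [isUnit_iff_constantCoeff, map_mul, map_add]
    have : constantCoeff f = r⁻¹ := by simpa using h0
    rw [this, hπ, hD]
    simp [hτ0, hr0]
  have hdiv : X ^ 5 ∣ (f - π) * ((f + π) * D) := by
    have : (f - π) * ((f + π) * D) = - (π * π * D - 1) := by linear_combination h
    rw [this]
    exact (dvd_neg).2 hd
  exact (hunit.dvd_mul_right).1 hdiv

end Jets

end PowerSeriesAlgebra

/-! ### Expansion of the force between the binaries -/

section ForceSeries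

open PowerSeries

/-- A coordinate of the separation of two bodies of different binaries. -/
def sepCoord {A : Type*} [CommRing A] [Algebra ℝ A] (ξ κ κ' : ℝ) (α α' : Fin 2 → ℝ) (S S' : A)
    (i k : Fin 2) : A :=
  algebraMap ℝ A ξ + algebraMap ℝ A (α i * κ) * S + algebraMap ℝ A (α' k * κ') * S'

/-- A sum over the four pairs of bodies of `c n / r³`, where `ψ = 1 / r`. -/
def forceSum {A : Type*} [CommRing A] [Algebra ℝ A] (c : Fin 2 → Fin 2 → ℝ)
    (ψ n : Fin 2 → Fin 2 → A) : A :=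
  ∑ i, ∑ k, algebraMap ℝ A (c i k) * ψ i k ^ 3 * n i k

theorem algebraMap_eq_C_C (c : ℝ) : algebraMap ℝ ℝ⟦X⟧⟦X⟧ c = C (C c) := by
  rw [PowerSeries.algebraMap_apply, PowerSeries.algebraMap_apply]; rfl

section Map

variable {A B : Type*} [CommRing A] [Algebra ℝ A] [CommRing B] [Algebra ℝ B] (f : A →ₐ[ℝ] B)

theorem map_sepCoord (ξ κ κ' : ℝ) (α α' : Fin 2 → ℝ) (S S' : A) (i k : Fin 2) :
    f (sepCoord ξ κ κ' α α' S S' i k) = sepCoord ξ κ κ' α α' (f S) (f S') i k := by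
  simp [sepCoord]

theorem map_forceSum (c : Fin 2 → Fin 2 → ℝ) (ψ n : Fin 2 → Fin 2 → A) :
    f (forceSum c ψ n) = forceSum c (fun i k => f (ψ i k)) (fun i k => f (n i k)) := by
  simp [forceSum]

end Map

variable {S S' : ℝ⟦X⟧⟦X⟧}

theorem coeff_zero_sepCoord (hS0 : coeff 0 S = 0) (ξ κ κ' : ℝ) (α α' : Fin 2 → ℝ) (i k : Fin 2) :
    coeff 0 (sepCoord ξ κ κ' α α' S S' i k) = C ξ + C (α' k * κ') * coeff 0 S' := by
  simp only [sepCoord, algebraMap_eq_C_C, map_add, coeff_C_mul, coeff_C, hS0]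
  simp

theorem coeff_one_sepCoord (hS1 : coeff 1 S = 0) (hS'1 : coeff 1 S' = 0)
    (ξ κ κ' : ℝ) (α α' : Fin 2 → ℝ) (i k : Fin 2) :
    coeff 1 (sepCoord ξ κ κ' α α' S S' i k) = 0 := by
  simp only [sepCoord, algebraMap_eq_C_C, map_add, coeff_C_mul, coeff_C, hS1, hS'1]
  simp

theorem coeff_two_sepCoord (hS2 : coeff 2 S = 1) (hS'2 : coeff 2 S' = 0)
    (ξ κ κ' : ℝ) (α α' : Fin 2 → ℝ) (i k : Fin 2) :
    coeff 2 (sepCoord ξ κ κ' α α' S S' i k) = C (α i * κ) := by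
  simp only [sepCoord, algebraMap_eq_C_C, map_add, coeff_C_mul, coeff_C, hS2, hS'2]
  simp

theorem coeff_one_forceSum {c : Fin 2 → Fin 2 → ℝ} {ψ n : Fin 2 → Fin 2 → ℝ⟦X⟧⟦X⟧}
    (hψ : ∀ i k, coeff 1 (ψ i k) = 0) (hn : ∀ i k, coeff 1 (n i k) = 0) :
    coeff 1 (forceSum c ψ n) = 0 := by
  simp only [forceSum, map_sum]
  refine Finset.sum_eq_zero fun i _ => Finset.sum_eq_zero fun k _ => ?_
  rw [algebraMap_eq_C_C, mul_assoc, coeff_C_mul]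
  simp [pow_succ, coeff_one_mul', coeff_zero_mul', hψ, hn]

theorem coeff_zero_forceSum {M M' α : Fin 2 → ℝ} (hMα : ∑ i, M i * α i = 0)
    {ψ n : Fin 2 → Fin 2 → ℝ⟦X⟧⟦X⟧} {ρ ν : Fin 2 → ℝ⟦X⟧}
    (hψ : ∀ i k, coeff 0 (ψ i k) = ρ k) (hn : ∀ i k, coeff 0 (n i k) = ν k) :
    coeff 0 (forceSum (fun i k => M i * M' k * α i) ψ n) = 0 := by
  simp only [forceSum, map_sum]
  have h : ∀ i k, coeff 0 (algebraMap ℝ ℝ⟦X⟧⟦X⟧ (M i * M' k * α i) * ψ i k ^ 3 * n i k)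
      = C (M i * α i) * (C (M' k) * (ρ k ^ 3 * ν k)) := by
    intro i k
    rw [algebraMap_eq_C_C, mul_assoc, coeff_C_mul]
    simp only [pow_succ, coeff_zero_mul', hψ, hn, pow_zero, map_mul]
    simp
    ring
  simp only [h]
  rw [← Finset.sum_mul_sum, ← map_sum, hMα]
  simp

/-- In a domain inverse square roots agree up to sign, and the positive constant term fixes the
sign. Thus at s = 0 the inverse distance does not depend on the body chosen in the `j`-th binary. -/
theorem coeff_zero_eq_of_sq_mul_eq_one {f g D : ℝ⟦X⟧} (hf : f ^ 2 * D = 1) (hg : g ^ 2 * D = 1)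
    {r : ℝ} (hr : 0 < r) (hf0 : coeff 0 f = r) (hg0 : coeff 0 g = r) : f = g := by
  have hs : f + g ≠ 0 := by
    intro h
    have := congrArg (coeff 0) h
    rw [map_add, hf0, hg0] at this
    simp at this
    linarith
  have hD : D ≠ 0 := by rintro rfl; simp at hf
  have : (f - g) * ((f + g) * D) = 0 := by linear_combination hf - hg
  exact sub_eq_zero.1 ((mul_eq_zero.1 this).resolve_right (mul_ne_zero hs hD))

/-- The quartic coefficient of `1 / |x + A w + B w'|` at `A² B²`, with `a = ⟨x, w⟩`, `b = ⟨x, w'⟩`,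
`c = ⟨w, w'⟩`, `ρ = 1 / |x|`. -/
def quarticCoeff (ρ a b c w2 w2' : ℝ) : ℝ :=
  3 / 4 * w2 * w2' * ρ ^ 5 - 15 / 4 * w2 * b ^ 2 * ρ ^ 7 + 3 / 2 * c ^ 2 * ρ ^ 5
    - 15 * a * b * c * ρ ^ 7 - 15 / 4 * a ^ 2 * w2' * ρ ^ 7 + 105 / 4 * a ^ 2 * b ^ 2 * ρ ^ 9

/-- The expanded quantity is minus the second derivative of 1/|y| along `w`, that is, -2 times the
A² coefficient of 1/|y + A w|. At y = x + β τ w' its τ² coefficient is therefore -2 β² times the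
A²B² coefficient. -/
theorem IsJet.quartic {τ ρ ν : ℝ⟦X⟧} (hτ : X ^ 2 ∣ τ) {q a b c w2 w2' β : ℝ}
    (hρ : IsJet τ ρ q (- (β * b) * q ^ 3)
      (3 / 2 * (β * b) ^ 2 * q ^ 5 - 1 / 2 * (β ^ 2 * w2') * q ^ 3))
    (hν : IsJet τ ν a (β * c) 0) :
    IsJet τ (C w2 * ρ ^ 3 - C 3 * ρ ^ 5 * ν ^ 2) (w2 * q ^ 3 - 3 * q ^ 5 * a ^ 2)
      (β * (w2 * (-3 * b * q ^ 5) + 15 * b * q ^ 7 * a ^ 2 - 6 * q ^ 5 * a * c))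
      (β ^ 2 * (-2 * quarticCoeff q a b c w2 w2')) := by
  have h2 := hρ.mul hτ hρ
  have h3 := h2.mul hτ hρ
  have h5 := h3.mul hτ h2
  have h7 := h5.mul hτ (hν.mul hτ hν)
  have h := (h3.const_mul w2).add (h7.const_mul (-3))
  convert h using 1
  · simp only [map_neg]; ring
  · ring
  · ring
  · simp only [quarticCoeff]; ring

theorem IsJet.coeff {τ η f : ℝ⟦X⟧} (hτ : τ = X ^ 2 * η) (hη : coeff 0 η = 1) {a c : ℝ}
    (h : IsJet τ f a 0 c) : PowerSeries.coeff 0 f = a ∧ PowerSeries.coeff 1 f = 0 ∧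
      PowerSeries.coeff 2 f = 0 ∧ PowerSeries.coeff 3 f = 0 ∧ PowerSeries.coeff 4 f = c := by
  have h' : ∀ m < 5, PowerSeries.coeff m f = PowerSeries.coeff m (C a + C c * (X ^ 4 * η ^ 2)) := by
    intro m hm
    have := X_pow_dvd_iff.1 h m hm
    rw [map_sub, sub_eq_zero] at this
    rw [this, hτ]
    congr 1
    simp only [map_zero]
    ring
  rw [h' 0, h' 1, h' 2, h' 3, h' 4]
  · simp only [map_add, coeff_C_mul, coeff_X_pow_mul', coeff_C]
    norm_num
    rw [← coeff_zero_eq_constantCoeff_apply, hη]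
    ring
  all_goals norm_num

-- At s = 0 all data are independent of the body `i`, so `hMα` annihilates the force. At s² a second
-- factor `α i` appears, and the sum over `i` no longer cancels. In the other variable the same
-- mechanism, through `hMα'`, removes the first power of τ and leaves the constant and the τ² term,
-- that is, t⁰ and t⁴.
set_option maxHeartbeats 1000000 in
theorem coeff_forceSum (hS0 : coeff 0 S = 0) (hS1 : coeff 1 S = 0) (hS2 : coeff 2 S = 1)
    (hS'1 : coeff 1 S' = 0) (hS'2 : coeff 2 S' = 0)
    {M M' α α' : Fin 2 → ℝ} (hMα : ∑ i, M i * α i = 0)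
    (hMα' : ∑ i, M' i * α' i = 0) {η : ℝ⟦X⟧} (hη : coeff 0 η = 1) (hS'0 : coeff 0 S' = X ^ 2 * η)
    {x w w' : ℂ} (hx : x ≠ 0) {ψ : Fin 2 → Fin 2 → ℝ⟦X⟧⟦X⟧}
    (hψ0 : ∀ i k, coeff 0 (coeff 0 (ψ i k)) = ‖x‖⁻¹)
    (hψ : ∀ i k, ψ i k ^ 2 * (sepCoord x.re w.re w'.re α α' S S' i k ^ 2
      + sepCoord x.im w.im w'.im α α' S S' i k ^ 2) = 1) :
    (∀ i k, coeff 1 (ψ i k) = 0) ∧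
    (∀ u v : ℝ, coeff 0 (forceSum (fun i k => M i * M' k * α i) ψ fun i k =>
      algebraMap ℝ _ u * sepCoord x.re w.re w'.re α α' S S' i k
        + algebraMap ℝ _ v * sepCoord x.im w.im w'.im α α' S S' i k) = 0) ∧
    ∃ G, G = coeff 2 (forceSum (fun i k => M i * M' k * α i) ψ fun i k =>
        algebraMap ℝ _ w.re * sepCoord x.re w.re w'.re α α' S S' i k
        + algebraMap ℝ _ w.im * sepCoord x.im w.im w'.im α α' S S' i k) ∧
      coeff 0 G = (∑ i, M i * α i ^ 2) * (∑ k, M' k) *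
        ((w.re ^ 2 + w.im ^ 2) * ‖x‖⁻¹ ^ 3 - 3 * ‖x‖⁻¹ ^ 5 * (w.re * x.re + w.im * x.im) ^ 2) ∧
      coeff 1 G = 0 ∧ coeff 2 G = 0 ∧ coeff 3 G = 0 ∧
      coeff 4 G = (∑ i, M i * α i ^ 2) * (∑ k, M' k * α' k ^ 2) *
        (-2 * quarticCoeff ‖x‖⁻¹ (w.re * x.re + w.im * x.im) (w'.re * x.re + w'.im * x.im)
          (w.re * w'.re + w.im * w'.im) (w.re ^ 2 + w.im ^ 2) (w'.re ^ 2 + w'.im ^ 2)) := by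
  have hrpos : 0 < ‖x‖ := norm_pos_iff.2 hx
  have hr2 : x.re ^ 2 + x.im ^ 2 = ‖x‖ ^ 2 := by
    rw [← Complex.normSq_eq_norm_sq, Complex.normSq_apply]; ring
  set τ : ℝ⟦X⟧ := X ^ 2 * η with hτ
  have hτd : X ^ 2 ∣ τ := ⟨η, rfl⟩
  set ur := sepCoord x.re w.re w'.re α α' S S' with hur
  set ui := sepCoord x.im w.im w'.im α α' S S' with hui
  set yr : Fin 2 → ℝ⟦X⟧ := fun k => C x.re + C (α' k * w'.re) * τ with hyr
  set yi : Fin 2 → ℝ⟦X⟧ := fun k => C x.im + C (α' k * w'.im) * τ with hyi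
  have ur0 : ∀ i k, coeff 0 (ur i k) = yr k := fun i k => by
    rw [hur, coeff_zero_sepCoord hS0, hS'0]
  have ui0 : ∀ i k, coeff 0 (ui i k) = yi k := fun i k => by
    rw [hui, coeff_zero_sepCoord hS0, hS'0]
  have ur1 : ∀ i k, coeff 1 (ur i k) = 0 := coeff_one_sepCoord hS1 hS'1 _ _ _ _ _
  have ui1 : ∀ i k, coeff 1 (ui i k) = 0 := coeff_one_sepCoord hS1 hS'1 _ _ _ _ _
  have ur2 : ∀ i k, coeff 2 (ur i k) = C (α i * w.re) := coeff_two_sepCoord hS2 hS'2 _ _ _ _ _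
  have ui2 : ∀ i k, coeff 2 (ui i k) = C (α i * w.im) := coeff_two_sepCoord hS2 hS'2 _ _ _ _ _
  have hD1 : ∀ i k, coeff 1 (ur i k ^ 2 + ui i k ^ 2) = 0 := fun i k => by
    simp [pow_two, coeff_one_mul', ur1, ui1]
  have hD0 : ∀ i k, coeff 0 (ψ i k) ^ 2 * (yr k ^ 2 + yi k ^ 2) = 1 := fun i k => by
    have := congrArg (coeff 0) (hψ i k)
    simp only [pow_two, map_add, coeff_zero_mul', ur0, ui0] at this
    simp only [pow_two]
    rw [this]
    simp
  set ρ : Fin 2 → ℝ⟦X⟧ := fun k => coeff 0 (ψ 0 k) with hρ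
  have hψρ : ∀ i k, coeff 0 (ψ i k) = ρ k := fun i k =>
    coeff_zero_eq_of_sq_mul_eq_one (hD0 i k) (hD0 0 k) (inv_pos.2 hrpos) (hψ0 i k) (hψ0 0 k)
  have hψ1 : ∀ i k, coeff 1 (ψ i k) = 0 := fun i k =>
    (coeff_one_of_sq_mul_eq_one (hψ i k) (hD1 i k)).1
  set ν : Fin 2 → ℝ⟦X⟧ := fun k => C w.re * yr k + C w.im * yi k with hν
  have hψ2 : ∀ i k, coeff 2 (ψ i k) = - C (α i) * ρ k ^ 3 * ν k := fun i k => by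
    rw [(coeff_one_of_sq_mul_eq_one (hψ i k) (hD1 i k)).2, hψρ]
    simp only [pow_two (ur i k), pow_two (ui i k), map_add, coeff_two_mul', ur0, ui0, ur1, ui1, ur2,
      ui2, hν, map_mul]
    have h3 : (2 : ℝ⟦X⟧) * C (1 / 2) = 1 := by
      rw [← map_ofNat (C (R := ℝ)) 2, ← map_mul]; norm_num
    linear_combination - C (α i) * ρ k ^ 3 * (C w.re * yr k + C w.im * yi k) * h3
  refine ⟨hψ1, fun u v => ?_, _, rfl, ?_⟩
  · refine coeff_zero_forceSum hMα (ν := fun k => C u * yr k + C v * yi k) hψρ fun i k => ?_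
    rw [map_add, algebraMap_eq_C_C, algebraMap_eq_C_C, coeff_C_mul, coeff_C_mul, ur0, ui0]
  have hG : coeff 2 (forceSum (fun i k => M i * M' k * α i) ψ fun i k =>
        algebraMap ℝ _ w.re * ur i k + algebraMap ℝ _ w.im * ui i k)
      = C (∑ i, M i * α i ^ 2) * ∑ k, C (M' k) *
        (C (w.re ^ 2 + w.im ^ 2) * ρ k ^ 3 - C 3 * ρ k ^ 5 * ν k ^ 2) := by
    have h : ∀ i k, coeff 2 (algebraMap ℝ ℝ⟦X⟧⟦X⟧ (M i * M' k * α i) * ψ i k ^ 3 *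
          (algebraMap ℝ _ w.re * ur i k + algebraMap ℝ _ w.im * ui i k))
        = C (M i * α i ^ 2) * (C (M' k) *
          (C (w.re ^ 2 + w.im ^ 2) * ρ k ^ 3 - C 3 * ρ k ^ 5 * ν k ^ 2)) := by
      intro i k
      have hn0 : coeff 0 (algebraMap ℝ ℝ⟦X⟧⟦X⟧ w.re * ur i k + algebraMap ℝ _ w.im * ui i k)
          = ν k := by
        rw [map_add, algebraMap_eq_C_C, algebraMap_eq_C_C, coeff_C_mul, coeff_C_mul, ur0, ui0]
      have hn1 : coeff 1 (algebraMap ℝ ℝ⟦X⟧⟦X⟧ w.re * ur i k + algebraMap ℝ _ w.im * ui i k)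
          = 0 := by
        rw [map_add, algebraMap_eq_C_C, algebraMap_eq_C_C, coeff_C_mul, coeff_C_mul, ur1, ui1]
        simp
      have hn2 : coeff 2 (algebraMap ℝ ℝ⟦X⟧⟦X⟧ w.re * ur i k + algebraMap ℝ _ w.im * ui i k)
          = C (α i) * C (w.re ^ 2 + w.im ^ 2) := by
        rw [map_add, algebraMap_eq_C_C, algebraMap_eq_C_C, coeff_C_mul, coeff_C_mul, ur2, ui2]
        simp only [map_mul, map_add, pow_two]
        ring
      have hp0 : coeff 0 (ψ i k ^ 3) = ρ k ^ 3 := by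
        simp only [pow_succ, pow_zero, one_mul, coeff_zero_mul', hψρ]
      have hp1 : coeff 1 (ψ i k ^ 3) = 0 := by
        simp only [pow_succ, pow_zero, one_mul, coeff_one_mul', hψ1]; simp
      have hp2 : coeff 2 (ψ i k ^ 3) = 3 * ρ k ^ 2 * (- C (α i) * ρ k ^ 3 * ν k) := by
        simp only [pow_succ, pow_zero, one_mul, coeff_two_mul', coeff_one_mul', coeff_zero_mul', hψ1,
          hψ2, hψρ]
        ring
      rw [algebraMap_eq_C_C (M i * M' k * α i), mul_assoc, coeff_C_mul, coeff_two_mul', hn0, hn1,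
        hn2, hp0, hp1, hp2]
      simp only [map_mul, map_pow, map_ofNat]
      ring
    simp only [forceSum, map_sum] at h ⊢
    simp only [h]
    rw [← Finset.sum_mul_sum]
  set a : ℝ := w.re * x.re + w.im * x.im with ha
  set b : ℝ := w'.re * x.re + w'.im * x.im with hb
  set c : ℝ := w.re * w'.re + w.im * w'.im with hc
  have hjet : ∀ k, IsJet τ (C (w.re ^ 2 + w.im ^ 2) * ρ k ^ 3 - C 3 * ρ k ^ 5 * ν k ^ 2)
      ((w.re ^ 2 + w.im ^ 2) * ‖x‖⁻¹ ^ 3 - 3 * ‖x‖⁻¹ ^ 5 * a ^ 2)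
      (α' k * ((w.re ^ 2 + w.im ^ 2) * (-3 * b * ‖x‖⁻¹ ^ 5) + 15 * b * ‖x‖⁻¹ ^ 7 * a ^ 2
        - 6 * ‖x‖⁻¹ ^ 5 * a * c)) (α' k ^ 2 * (-2 * quarticCoeff ‖x‖⁻¹ a b c
          (w.re ^ 2 + w.im ^ 2) (w'.re ^ 2 + w'.im ^ 2))) := by
    intro k
    refine IsJet.quartic hτd (IsJet.inv_sqrt hτd hrpos ?_ (hψ0 0 k)) ?_
    · rw [← hD0 0 k, ← hr2]
      simp only [hyr, hyi, hb, map_add, map_mul, map_pow, map_ofNat]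
      ring
    · have : ν k = C a + C (α' k * c) * τ := by
        simp only [hν, hyr, hyi, ha, hc, map_add, map_mul]
        ring
      rw [this]
      exact isJet_affine _ _
  rw [hG]
  have hsum := ((hjet 0).const_mul (M' 0)).add ((hjet 1).const_mul (M' 1))
  have htot := hsum.const_mul (∑ i, M i * α i ^ 2)
  simp only [Fin.sum_univ_two] at hMα' htot ⊢
  -- The τ-linear part is linear in `α' k`, so the centre-of-mass relation of the other binary
  -- removes it.
  have hzero : (M 0 * α 0 ^ 2 + M 1 * α 1 ^ 2) *
      (M' 0 * (α' 0 * ((w.re ^ 2 + w.im ^ 2) * (-3 * b * ‖x‖⁻¹ ^ 5) + 15 * b * ‖x‖⁻¹ ^ 7 * a ^ 2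
        - 6 * ‖x‖⁻¹ ^ 5 * a * c)) + M' 1 * (α' 1 * ((w.re ^ 2 + w.im ^ 2) *
        (-3 * b * ‖x‖⁻¹ ^ 5) + 15 * b * ‖x‖⁻¹ ^ 7 * a ^ 2 - 6 * ‖x‖⁻¹ ^ 5 * a * c))) = 0 := by
    linear_combination (M 0 * α 0 ^ 2 + M 1 * α 1 ^ 2) * ((w.re ^ 2 + w.im ^ 2) *
      (-3 * b * ‖x‖⁻¹ ^ 5) + 15 * b * ‖x‖⁻¹ ^ 7 * a ^ 2 - 6 * ‖x‖⁻¹ ^ 5 * a * c) * hMα'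
  rw [hzero] at htot
  obtain ⟨h0, h1, h2, h3, h4⟩ := IsJet.coeff hτ hη htot
  refine ⟨?_, h1, h2, h3, ?_⟩
  · rw [h0]; ring
  · rw [h4]; ring

end ForceSeries

/-! ### Gradients of the coupling potential -/

theorem hasGradientAt_div_norm {y : ℂ → ℂ} {y' w : ℂ} (hy : HasDerivAt y y' w) (h0 : y w ≠ 0)
    (c : ℝ) : HasGradientAt (fun w => c / ‖y w‖)
      (((-(c * ‖y w‖⁻¹ ^ 3) : ℝ) : ℂ) * (y w * conj y')) w := by
  rw [hasGradientAt_iff_hasFDerivAt]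
  have h1 := (hy.hasFDerivAt.restrictScalars ℝ).norm_sq
  have hpos : 0 < ‖y w‖ := norm_pos_iff.2 h0
  have h2 : HasDerivAt (fun r : ℝ => c / √r) (-(c * ‖y w‖⁻¹ ^ 3) / 2) (‖y w‖ ^ 2) := by
    have h3 := (Real.hasDerivAt_sqrt (x := ‖y w‖ ^ 2) (by positivity)).inv
      (by rw [Real.sqrt_sq hpos.le]; exact hpos.ne')
    have h4 := h3.const_mul c
    simp only [Real.sqrt_sq hpos.le] at h4
    exact h4.congr_deriv (by field_simp)
  have h5 := h2.comp_hasFDerivAt w h1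
  have h6 : ((fun r : ℝ => c / √r) ∘ fun x => ‖y x‖ ^ 2) = fun w => c / ‖y w‖ := by
    funext x
    simp [Real.sqrt_sq (norm_nonneg _)]
  rw [h6] at h5
  refine h5.congr_fderiv (ContinuousLinearMap.ext fun v => ?_)
  generalize -(c * ‖y w‖⁻¹ ^ 3) = κ
  simp only [InnerProductSpace.toDual_apply_apply, Complex.inner, map_mul, Complex.conj_ofReal,
    Complex.conj_conj, _root_.smul_apply, ContinuousLinearMap.comp_apply,
    innerSL_apply_apply, ContinuousLinearMap.coe_restrictScalars', smul_eq_mul,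
    ContinuousLinearMap.toSpanSingleton_apply, nsmul_eq_mul]
  simp [Complex.mul_re, Complex.mul_im]
  ring

namespace FourBody

/-- The masses of the two bodies of the `j`-th binary. -/
def bodyMass (m : Fin 4 → ℝ) (j : Fin 2) : Fin 2 → ℝ := ![![m 0, m 1], ![m 2, m 3]] j

/-- The coefficients of `Q_j` in the separations of the bodies. -/
def sepCoef (m : Fin 4 → ℝ) (j : Fin 2) : Fin 2 → ℝ :=
  ![![redMass m 0 / m 0, -(redMass m 0 / m 1)], ![-(redMass m 1 / m 2), redMass m 1 / m 3]] j

theorem coupling_eq (m : Fin 4 → ℝ) (Q : Fin 2 → ℂ) (x : ℂ) (j : Fin 2) :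
    coupling m Q x = ∑ i, ∑ k, bodyMass m j i * bodyMass m (1 - j) k /
      ‖x + sepCoef m j i * Q j + sepCoef m (1 - j) k * Q (1 - j)‖ := by
  fin_cases j
  · simp [coupling, bodyMass, sepCoef, Fin.sum_univ_two]
    simp only [sub_eq_add_neg]
    ring
  · simp [coupling, bodyMass, sepCoef, Fin.sum_univ_two]
    simp only [sub_eq_add_neg, add_right_comm x]
    ring

theorem redMass_pos {m : Fin 4 → ℝ} (hm : ∀ i, 0 < m i) (j : Fin 2) : 0 < redMass m j := by
  have h0 := hm 0
  have h1 := hm 1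
  have h2 := hm 2
  have h3 := hm 3
  fin_cases j <;> simp [redMass] <;> positivity

theorem massProd_pos {m : Fin 4 → ℝ} (hm : ∀ i, 0 < m i) (j : Fin 2) : 0 < massProd m j := by
  have h0 := hm 0
  have h1 := hm 1
  have h2 := hm 2
  have h3 := hm 3
  fin_cases j <;> simp [massProd] <;> positivity

theorem aConst_pos {m : Fin 4 → ℝ} (hm : ∀ i, 0 < m i) (j : Fin 2) : 0 < aConst m j := by
  have := redMass_pos hm j
  have := massProd_pos hm j
  unfold aConst
  positivity

theorem sum_bodyMass_mul_sepCoef {m : Fin 4 → ℝ} (hm : ∀ i, 0 < m i) (j : Fin 2) :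
    ∑ i, bodyMass m j i * sepCoef m j i = 0 := by
  have h0 := (hm 0).ne'
  have h1 := (hm 1).ne'
  have h2 := (hm 2).ne'
  have h3 := (hm 3).ne'
  fin_cases j <;> simp [bodyMass, sepCoef, Fin.sum_univ_two] <;> field_simp <;> ring

theorem sum_bodyMass_mul_sepCoef_sq_pos {m : Fin 4 → ℝ} (hm : ∀ i, 0 < m i)
    (j : Fin 2) : 0 < ∑ i, bodyMass m j i * sepCoef m j i ^ 2 := by
  have h0 := hm 0
  have h1 := hm 1
  have h2 := hm 2
  have h3 := hm 3
  have r0 := redMass_pos hm 0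
  have r1 := redMass_pos hm 1
  fin_cases j <;> simp [bodyMass, sepCoef, Fin.sum_univ_two] <;> positivity

/-- The separation of two bodies, in Levi-Civita variables. -/
def sepLC (m : Fin 4 → ℝ) (j : Fin 2) (z : Fin 2 → ℂ) (x : ℂ) (i k : Fin 2) : ℂ :=
  x + sepCoef m j i * (z j ^ 2 / 2 / ((4 * massProd m j * redMass m j : ℝ) : ℂ))
    + sepCoef m (1 - j) k *
      (z (1 - j) ^ 2 / 2 / ((4 * massProd m (1 - j) * redMass m (1 - j) : ℝ) : ℂ))

theorem couplingLC_eq (m : Fin 4 → ℝ) (z : Fin 2 → ℂ) (x : ℂ) (j : Fin 2) :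
    couplingLC m z x = ∑ i, ∑ k, bodyMass m j i * bodyMass m (1 - j) k / ‖sepLC m j z x i k‖ :=
  coupling_eq m _ x j

theorem hasGradientAt_finsetSum {ι : Type*} (s : Finset ι) {f : ι → ℂ → ℝ} {g : ι → ℂ} {w : ℂ}
    (h : ∀ i ∈ s, HasGradientAt (f i) (g i) w) :
    HasGradientAt (fun w => ∑ i ∈ s, f i w) (∑ i ∈ s, g i) w := by
  rw [hasGradientAt_iff_hasFDerivAt, map_sum]
  exact HasFDerivAt.fun_sum fun i hi => (h i hi).hasFDerivAt

theorem one_sub_ne (j : Fin 2) : 1 - j ≠ j := by fin_cases j <;> decide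

theorem one_sub_one_sub (j : Fin 2) : 1 - (1 - j) = j := by fin_cases j <;> rfl

theorem gradX_eq (m : Fin 4 → ℝ) (z : Fin 2 → ℂ) (x : ℂ) (j : Fin 2)
    (h0 : ∀ i k, sepLC m j z x i k ≠ 0) :
    gradX m z x = ∑ i, ∑ k, ((-(bodyMass m j i * bodyMass m (1 - j) k *
      ‖sepLC m j z x i k‖⁻¹ ^ 3) : ℝ) : ℂ) * sepLC m j z x i k := by
  refine HasGradientAt.gradient ?_
  simp only [couplingLC_eq m _ _ j]
  refine hasGradientAt_finsetSum _ fun i _ => hasGradientAt_finsetSum _ fun k _ => ?_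
  have hd : HasDerivAt (fun w => sepLC m j z w i k) 1 x :=
    ((hasDerivAt_id x).add_const _).add_const _
  simpa using hasGradientAt_div_norm hd (h0 i k) (bodyMass m j i * bodyMass m (1 - j) k)

theorem gradZ_eq (m : Fin 4 → ℝ) (z : Fin 2 → ℂ) (x : ℂ) (j : Fin 2)
    (h0 : ∀ i k, sepLC m j z x i k ≠ 0) :
    gradZ m z x j = ∑ i, ∑ k, ((-(bodyMass m j i * bodyMass m (1 - j) k *
      ‖sepLC m j z x i k‖⁻¹ ^ 3) : ℝ) : ℂ) * (sepLC m j z x i k *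
        conj (sepCoef m j i * (z j / ((4 * massProd m j * redMass m j : ℝ) : ℂ)))) := by
  refine HasGradientAt.gradient ?_
  simp only [couplingLC_eq m _ _ j]
  refine hasGradientAt_finsetSum _ fun i _ => hasGradientAt_finsetSum _ fun k _ => ?_
  have hu : ∀ w, sepLC m j (Function.update z j w) x i k
      = x + sepCoef m j i * (w ^ 2 / 2 / ((4 * massProd m j * redMass m j : ℝ) : ℂ))
        + sepCoef m (1 - j) k *
      (z (1 - j) ^ 2 / 2 / ((4 * massProd m (1 - j) * redMass m (1 - j) : ℝ) : ℂ)) := by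
    intro w
    simp [sepLC, Function.update_of_ne (one_sub_ne j)]
  have hd : HasDerivAt (fun w => sepLC m j (Function.update z j w) x i k)
      (sepCoef m j i * (z j / ((4 * massProd m j * redMass m j : ℝ) : ℂ))) (z j) := by
    simp only [hu]
    have h1 : HasDerivAt (fun w : ℂ => w ^ 2) (2 * z j) (z j) := by
      simpa using hasDerivAt_pow 2 (z j)
    have h2 := ((((h1.div_const 2).div_const ((4 * massProd m j * redMass m j : ℝ) : ℂ)).const_mul
      (sepCoef m j i : ℂ)).const_add x).add_const (sepCoef m (1 - j) k *
      (z (1 - j) ^ 2 / 2 / ((4 * massProd m (1 - j) * redMass m (1 - j) : ℝ) : ℂ)))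
    exact h2.congr_deriv (by ring)
  have h := hasGradientAt_div_norm hd (by simpa using h0 i k)
    (bodyMass m j i * bodyMass m (1 - j) k)
  simpa only [Function.update_eq_self] using h

theorem sepLC_swap (m : Fin 4 → ℝ) (j : Fin 2) (z : Fin 2 → ℂ) (x : ℂ) (i k : Fin 2) :
    sepLC m (1 - j) z x k i = sepLC m j z x i k := by
  simp only [sepLC, one_sub_one_sub]
  ring

theorem gradZ_one_sub_eq (m : Fin 4 → ℝ) (z : Fin 2 → ℂ) (x : ℂ) (j : Fin 2)
    (h0 : ∀ i k, sepLC m j z x i k ≠ 0) :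
    gradZ m z x (1 - j) = ∑ i, ∑ k, ((-(bodyMass m j i * bodyMass m (1 - j) k *
      ‖sepLC m j z x i k‖⁻¹ ^ 3) : ℝ) : ℂ) * (sepLC m j z x i k *
        conj (sepCoef m (1 - j) k *
          (z (1 - j) / ((4 * massProd m (1 - j) * redMass m (1 - j) : ℝ) : ℂ)))) := by
  rw [gradZ_eq m z x (1 - j) fun k i => by rw [sepLC_swap]; exact h0 i k, Finset.sum_comm]
  simp only [sepLC_swap, one_sub_one_sub, mul_comm (bodyMass m (1 - j) _)]

end FourBody

/-! ### The rescaled field on the plane of real ζ₁, ζ₂ -/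

namespace FourBody

/-- The coordinate directions. -/
def dirI (j : Fin 2) : Phase := (Pi.single j 1, 0, 0, 0, 0)
def dirL (j : Fin 2) : Phase := (Pi.single j Complex.I, 0, 0, 0, 0)
def dirT (j : Fin 2) : Phase := (0, 0, Pi.single j 1, 0, 0)
def dirX (c : ℂ) : Phase := (0, 0, 0, c, 0)
def dirY (c : ℂ) : Phase := (0, 0, 0, 0, c)

theorem phase_eq_sum (p : Phase) (j : Fin 2) :
    p = (p.1 j).re • dirI j + (p.1 j).im • dirL j
      + ((p.1 (1 - j)).re • dirI (1 - j) + (p.1 (1 - j)).im • dirL (1 - j))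
      + (p.2.1 j • dirH j + p.2.1 (1 - j) • dirH (1 - j))
      + (p.2.2.1 j • dirT j + p.2.2.1 (1 - j) • dirT (1 - j))
      + dirX p.2.2.2.1 + (p.2.2.2.2.re • dirY 1 + p.2.2.2.2.im • dirY Complex.I) := by
  obtain ⟨ζ, h, θ, x, y⟩ := p
  refine Prod.ext ?_ (Prod.ext ?_ (Prod.ext ?_ (Prod.ext ?_ ?_)))
  · funext i
    fin_cases j <;> fin_cases i <;>
      simp [dirI, dirL, dirH, dirT, dirX, dirY, Complex.re_add_im]
  · funext i
    fin_cases j <;> fin_cases i <;> simp [dirI, dirL, dirH, dirT, dirX, dirY]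
  · funext i
    fin_cases j <;> fin_cases i <;> simp [dirI, dirL, dirH, dirT, dirX, dirY]
  · simp [dirI, dirL, dirH, dirT, dirX, dirY]
  · simp [dirI, dirL, dirH, dirT, dirX, dirY, Complex.re_add_im]

/-- The scaled square of the direction of `u_j`: along real `ζ_j`, the difference vector `Q_j` is a
real multiple of it. -/
def axis (m : Fin 4 → ℝ) (j : Fin 2) (θ : ℝ) : ℂ :=
  (((aConst m j ^ (1 / 3 : ℝ)) ^ 2 / (2 * (4 * massProd m j * redMass m j)) : ℝ) : ℂ)
    * Complex.exp (θ * Complex.I) ^ 2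

/-- For real ζ_j the product z_j Γ_j is a real multiple of the axis of Q_j. The rotated force then
splits into its components along that axis and perpendicular to it, which are polynomial in inverse
distances and coordinates. -/
theorem conj_force (c a : Fin 2 → Fin 2 → ℝ) (ψ yr yi : Fin 2 → Fin 2 → ℝ) (ζ Γ w : ℂ) (l : ℝ)
    (h : ζ * Γ = l * w) :
    Γ * conj (∑ i, ∑ k, ((-(c i k * ψ i k ^ 3) : ℝ) : ℂ) * ((⟨yr i k, yi i k⟩ : ℂ) *
      conj (a i k * ζ))) = ((-l : ℝ) : ℂ) *
        ⟨forceSum (fun i k => c i k * a i k) ψ (fun i k => w.re * yr i k + w.im * yi i k),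
          forceSum (fun i k => c i k * a i k) ψ (fun i k => w.im * yr i k + -w.re * yi i k)⟩ := by
  have h1 : ∀ i k, Γ * conj (((-(c i k * ψ i k ^ 3) : ℝ) : ℂ) * ((⟨yr i k, yi i k⟩ : ℂ) *
      conj (a i k * ζ))) = ((-l : ℝ) : ℂ) * ⟨c i k * a i k * ψ i k ^ 3 *
        (w.re * yr i k + w.im * yi i k), c i k * a i k * ψ i k ^ 3 *
        (w.im * yr i k + -w.re * yi i k)⟩ := by
    intro i k
    have h2 : Γ * conj (((-(c i k * ψ i k ^ 3) : ℝ) : ℂ) * ((⟨yr i k, yi i k⟩ : ℂ) *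
      conj (a i k * ζ))) = ((-(c i k * ψ i k ^ 3) : ℝ) : ℂ) * conj (⟨yr i k, yi i k⟩ : ℂ)
        * a i k * (ζ * Γ) := by
      simp only [map_mul, Complex.conj_ofReal, Complex.conj_conj]
      ring
    rw [h2, h]
    apply Complex.ext <;> simp [-Complex.ofReal_neg, -Complex.ofReal_mul, -Complex.ofReal_pow,
      Complex.mul_re, Complex.mul_im] <;> ring
  have h3 : ∀ f g : Fin 2 → Fin 2 → ℝ, (⟨∑ i, ∑ k, f i k, ∑ i, ∑ k, g i k⟩ : ℂ)
      = ∑ i, ∑ k, ⟨f i k, g i k⟩ := by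
    intro f g
    apply Complex.ext <;> simp
  simp only [forceSum, Algebra.algebraMap_self, RingHom.id_apply]
  rw [h3, map_sum, Finset.mul_sum, Finset.mul_sum]
  refine Finset.sum_congr rfl fun i _ => ?_
  rw [map_sum, Finset.mul_sum, Finset.mul_sum]
  exact Finset.sum_congr rfl fun k _ => h1 i k

section Plane

variable {m : Fin 4 → ℝ} {p : Phase} {j : Fin 2} {s V : ℝ}

theorem U_sq (hs : p.zeta j = s) (hV : V = (1 + √(1 + 4 * (p.h j * s ^ 2))) / 2) :
    p.U j ^ 2 = V := by
  rw [Phase.U, Real.sq_sqrt (by positivity), hV, hs]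
  simp [mul_assoc]

theorem U_pos : 0 < p.U j := by
  unfold Phase.U
  positivity

theorem z_sq_eq (hm : ∀ i, 0 < m i) {Y : ℝ} (hs : p.zeta j = s)
    (hV : V = (1 + √(1 + 4 * (p.h j * s ^ 2))) / 2) (hY : V * Y = 1) :
    p.z m j ^ 2 / 2 / ((4 * massProd m j * redMass m j : ℝ) : ℂ)
      = ((s ^ 2 * Y : ℝ) : ℂ) * axis m j (p.theta j) := by
  have hU := U_sq hs hV
  have hU0 : p.U j ≠ 0 := U_pos.ne'
  have hY' : Y = (p.U j ^ 2)⁻¹ := by rw [hU]; exact eq_inv_of_mul_eq_one_right hY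
  have h1 := (massProd_pos hm j).ne'
  have h2 := (redMass_pos hm j).ne'
  have h1' : (massProd m j : ℂ) ≠ 0 := by exact_mod_cast h1
  have h2' : (redMass m j : ℂ) ≠ 0 := by exact_mod_cast h2
  have h3' : (p.U j : ℂ) ≠ 0 := by exact_mod_cast hU0
  rw [Phase.z, axis, hs, hY']
  push_cast
  field_simp

theorem z_div_mul_eq (hm : ∀ i, 0 < m i) (hs : p.zeta j = s) :
    p.z m j / ((4 * massProd m j * redMass m j : ℝ) : ℂ) * Complex.exp (p.theta j * Complex.I)
      = ((2 * s * (aConst m j ^ (1 / 3 : ℝ))⁻¹ * (p.U j)⁻¹ : ℝ) : ℂ) * axis m j (p.theta j) := by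
  have hU0 : p.U j ≠ 0 := U_pos.ne'
  have h1 := (massProd_pos hm j).ne'
  have h2 := (redMass_pos hm j).ne'
  have h4 : aConst m j ^ (1 / 3 : ℝ) ≠ 0 := (Real.rpow_pos_of_pos (aConst_pos hm j) _).ne'
  have h1' : (massProd m j : ℂ) ≠ 0 := by exact_mod_cast h1
  have h2' : (redMass m j : ℂ) ≠ 0 := by exact_mod_cast h2
  have h3' : (p.U j : ℂ) ≠ 0 := by exact_mod_cast hU0
  have h4' : ((aConst m j ^ (1 / 3 : ℝ) : ℝ) : ℂ) ≠ 0 := by exact_mod_cast h4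
  rw [Phase.z, axis, hs]
  push_cast
  field_simp

end Plane

end FourBody

namespace FourBody

theorem dirX_smul (c : ℝ) (v : ℂ) : dirX ((c : ℂ) * v) = c • dirX v := by
  simp [dirX]

/-- The interaction terms: `u = 1`, `v = 0` and `u = 0`, `v = 1` give the components of the force,
and the coefficients `c` select the body or the binary on which it acts. -/
def interaction {A : Type*} [CommRing A] [Algebra ℝ A] (c : Fin 2 → Fin 2 → ℝ)
    (ψ yr yi : Fin 2 → Fin 2 → A) (u v : ℝ) : A :=
  forceSum c ψ fun i k => algebraMap ℝ A u * yr i k + algebraMap ℝ A v * yi i k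

theorem map_interaction {A B : Type*} [CommRing A] [Algebra ℝ A] [CommRing B] [Algebra ℝ B]
    (f : A →ₐ[ℝ] B) (c : Fin 2 → Fin 2 → ℝ) (ψ yr yi : Fin 2 → Fin 2 → A) (u v : ℝ) :
    f (interaction c ψ yr yi u v) = interaction c (fun i k => f (ψ i k)) (fun i k => f (yr i k))
      (fun i k => f (yi i k)) u v := by
  simp [interaction, map_forceSum]

/-- Products of the masses of two bodies of different binaries. -/
def pairMass (m : Fin 4 → ℝ) (j i k : Fin 2) : ℝ := bodyMass m j i * bodyMass m (1 - j) k

/-- `V` and `Y` stand for U_j² and its inverse. The odd powers of U_j and the phases cancel in every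
component, which leaves expressions that can be expanded as power series. -/
theorem field_plane {m : Fin 4 → ℝ} (hm : ∀ i, 0 < m i) {p : Phase} {j : Fin 2}
    {s t V Y V' Y' : ℝ} (hs : p.zeta j = s) (ht : p.zeta (1 - j) = t)
    (hV : V = (1 + √(1 + 4 * (p.h j * s ^ 2))) / 2)
    (hV' : V' = (1 + √(1 + 4 * (p.h (1 - j) * t ^ 2))) / 2)
    (hY : V * Y = 1) (hY' : V' * Y' = 1)
    (hV2 : V ^ 2 - V = p.h j * s ^ 2) (hV'2 : V' ^ 2 - V' = p.h (1 - j) * t ^ 2)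
    {w w' : ℂ} (hw : w = axis m j (p.theta j)) (hw' : w' = axis m (1 - j) (p.theta (1 - j)))
    {yr yi ψ : Fin 2 → Fin 2 → ℝ}
    (hyr : yr = sepCoord p.x.re w.re w'.re (sepCoef m j) (sepCoef m (1 - j)) (s ^ 2 * Y)
      (t ^ 2 * Y'))
    (hyi : yi = sepCoord p.x.im w.im w'.im (sepCoef m j) (sepCoef m (1 - j)) (s ^ 2 * Y)
      (t ^ 2 * Y'))
    (hψ : ∀ i k, ψ i k = (√(yr i k ^ 2 + yi i k ^ 2))⁻¹)
    (hne : ∀ i k, 0 < yr i k ^ 2 + yi i k ^ 2)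
    {e e' P Q P' Q' : ℝ} (he : e = (aConst m j ^ (1 / 3 : ℝ))⁻¹)
    (he' : e' = (aConst m (1 - j) ^ (1 / 3 : ℝ))⁻¹)
    (hP : P = interaction (fun i k => pairMass m j i k * sepCoef m j i) ψ yr yi w.re w.im)
    (hQ : Q = interaction (fun i k => pairMass m j i k * sepCoef m j i) ψ yr yi w.im (-w.re))
    (hP' : P' = interaction (fun i k => pairMass m j i k * sepCoef m (1 - j) k) ψ yr yi w'.re w'.im)
    (hQ' : Q' = interaction (fun i k => pairMass m j i k * sepCoef m (1 - j) k) ψ yr yi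
      w'.im (-w'.re))
    (D : Phase →L[ℝ] ℝ) :
    D (field m p) = transport s t (p.h j * Y * (2 * V + 1) - 2 * e * s ^ 2 * Y * P)
      (p.h (1 - j) * Y' * (2 * V' + 1) - 2 * e' * t ^ 2 * Y' * P')
      (- (2 * e) * Y * Q) (- (2 * e') * t ^ 2 * Y' * Q')
      (- (4 * e) * V * P) (- (4 * e') * t * V' * P')
      ((2 * e) * Y * Q) ((2 * e') * t * Y' * Q')
      (- interaction (pairMass m j) ψ yr yi 1 0) (- interaction (pairMass m j) ψ yr yi 0 1)
      (D (dirI j)) (D (dirI (1 - j))) (D (dirL j)) (D (dirL (1 - j))) (D (dirH j))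
      (D (dirH (1 - j))) (D (dirT j)) (D (dirT (1 - j))) (D (dirX (muConst m * p.y)))
      (D (dirY 1)) (D (dirY Complex.I)) := by
  have hy : ∀ i k, sepLC m j (p.z m) p.x i k = ⟨yr i k, yi i k⟩ := by
    intro i k
    rw [sepLC, z_sq_eq hm hs hV hY, z_sq_eq hm ht hV' hY', ← hw, ← hw', hyr, hyi]
    apply Complex.ext <;> simp [sepCoord, -Complex.ofReal_mul, -Complex.ofReal_pow] <;> ring
  have hy0 : ∀ i k, sepLC m j (p.z m) p.x i k ≠ 0 := by
    intro i k h
    have := hne i k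
    rw [hy] at h
    have h1 := congrArg Complex.re h
    have h2 := congrArg Complex.im h
    simp only [Complex.zero_re, Complex.zero_im] at h1 h2
    rw [h1, h2] at this
    simp at this
  have hyn : ∀ i k, ‖sepLC m j (p.z m) p.x i k‖⁻¹ = ψ i k := by
    intro i k
    rw [hψ, hy, Complex.norm_def, Complex.normSq_mk]
    simp only [pow_two]
  have hg := gradZ_eq m (p.z m) p.x j hy0
  have hg' := gradZ_one_sub_eq m (p.z m) p.x j hy0
  have hgx := gradX_eq m (p.z m) p.x j hy0
  simp only [hyn] at hg hg' hgx
  simp only [hy] at hg hg' hgx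
  set g : Fin 2 → ℂ := gradZ m (p.z m) p.x with hgdef
  set Γ := Complex.exp (p.theta j * Complex.I) with hΓ
  set Γ' := Complex.exp (p.theta (1 - j) * Complex.I) with hΓ'
  have hU0 : p.U j ≠ 0 := U_pos.ne'
  have hU0' : p.U (1 - j) ≠ 0 := U_pos.ne'
  have hU := U_sq hs hV
  have hU' := U_sq ht hV'
  have ha : aConst m j ^ (1 / 3 : ℝ) ≠ 0 := (Real.rpow_pos_of_pos (aConst_pos hm j) _).ne'
  have ha' : aConst m (1 - j) ^ (1 / 3 : ℝ) ≠ 0 :=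
    (Real.rpow_pos_of_pos (aConst_pos hm (1 - j)) _).ne'
  have hΓg : Γ * conj (g j) = ((-(2 * s * e * (p.U j)⁻¹) : ℝ) : ℂ) * ⟨P, Q⟩ := by
    rw [hg, conj_force (fun i k => bodyMass m j i * bodyMass m (1 - j) k)
      (fun i k => sepCoef m j i) ψ yr yi _ Γ w _ (by rw [hw, z_div_mul_eq hm hs]), he, hP, hQ]
    rfl
  have hΓg' : Γ' * conj (g (1 - j)) = ((-(2 * t * e' * (p.U (1 - j))⁻¹) : ℝ) : ℂ) * ⟨P', Q'⟩ := by
    rw [hg', conj_force (fun i k => bodyMass m j i * bodyMass m (1 - j) k)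
      (fun i k => sepCoef m (1 - j) k) ψ yr yi _ Γ' w' _ (by rw [hw', z_div_mul_eq hm ht]), he', hP',
      hQ']
    rfl
  have hYU : Y = (p.U j ^ 2)⁻¹ := by rw [hU]; exact eq_inv_of_mul_eq_one_right hY
  have hYU' : Y' = (p.U (1 - j) ^ 2)⁻¹ := by rw [hU']; exact eq_inv_of_mul_eq_one_right hY'
  have hzg : p.z m j * conj (g j) = ((-(2 * s ^ 2 * Y) : ℝ) : ℂ) * ⟨P, Q⟩ := by
    have : p.z m j * conj (g j) = ((aConst m j ^ (1 / 3 : ℝ) / p.U j * s : ℝ) : ℂ)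
        * (Γ * conj (g j)) := by
      rw [Phase.z, hs]; push_cast; ring
    rw [this, hΓg, ← mul_assoc, ← Complex.ofReal_mul, he, hYU]
    congr 2
    field_simp
  have hzg' : p.z m (1 - j) * conj (g (1 - j)) = ((-(2 * t ^ 2 * Y') : ℝ) : ℂ) * ⟨P', Q'⟩ := by
    have : p.z m (1 - j) * conj (g (1 - j))
        = ((aConst m (1 - j) ^ (1 / 3 : ℝ) / p.U (1 - j) * t : ℝ) : ℂ)
        * (Γ' * conj (g (1 - j))) := by
      rw [Phase.z, ht]; push_cast; ring
    rw [this, hΓg', ← mul_assoc, ← Complex.ofReal_mul, he', hYU']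
    congr 2
    field_simp
  have hug : p.u j * conj (g j) = ((-(2 * s * e) : ℝ) : ℂ) * ⟨P, Q⟩ := by
    have : p.u j * conj (g j) = (p.U j : ℂ) * (Γ * conj (g j)) := by
      rw [Phase.u]; ring
    rw [this, hΓg, ← mul_assoc, ← Complex.ofReal_mul]
    congr 2
    field_simp
  have hug' : p.u (1 - j) * conj (g (1 - j)) = ((-(2 * t * e') : ℝ) : ℂ) * ⟨P', Q'⟩ := by
    have : p.u (1 - j) * conj (g (1 - j)) = (p.U (1 - j) : ℂ) * (Γ' * conj (g (1 - j))) := by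
      rw [Phase.u]; ring
    rw [this, hΓg', ← mul_assoc, ← Complex.ofReal_mul]
    congr 2
    field_simp
  have hnorm : ‖p.zeta j‖ ^ 2 = s ^ 2 := by rw [hs]; simp
  have hnorm' : ‖p.zeta (1 - j)‖ ^ 2 = t ^ 2 := by rw [ht]; simp
  have hnn : ‖p.zeta 0‖ ^ 2 * ‖p.zeta 1‖ ^ 2 = s ^ 2 * t ^ 2 := by
    rw [← hnorm, ← hnorm']
    fin_cases j
    · simp
    · simp [mul_comm]
  have hrp : aConst m j ^ (-(1 / 3) : ℝ) = e := by
    rw [he, Real.rpow_neg (aConst_pos hm j).le]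
  have hrp' : aConst m (1 - j) ^ (-(1 / 3) : ℝ) = e' := by
    rw [he', Real.rpow_neg (aConst_pos hm (1 - j)).le]
  have hX1 : (field m p).1 j = ⟨t ^ 2 * (1 + s ^ 2 * (p.h j * Y * (2 * V + 1)
      - 2 * e * s ^ 2 * Y * P)), s ^ 4 * t ^ 2 * (-(2 * e) * Y * Q)⟩ := by
    change ((‖p.zeta (1 - j)‖ ^ 2 : ℝ) : ℂ) *
      (((p.U j ^ 2 * (2 * p.U j ^ 2 - 1) : ℝ) : ℂ)
        + ((aConst m j ^ (-(1 / 3) : ℝ) * ‖p.zeta j‖ ^ 2 : ℝ) : ℂ) * (p.z m j * conj (g j))) = _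
    rw [hnorm, hnorm', hzg, hU, hrp]
    apply Complex.ext
    · simp only [Complex.re_ofReal_mul, Complex.add_re, Complex.ofReal_re]
      -- V(2V - 1) - 1 = (V - 1)(2V + 1), and V - 1 = h_j s² Y.
      linear_combination t ^ 2 * (2 * V + 1) * (hV2 * Y - (V - 1) * hY)
    · simp only [Complex.im_ofReal_mul, Complex.add_im, Complex.ofReal_im]
      ring
  have hX1' : (field m p).1 (1 - j) = ⟨s ^ 2 * (1 + t ^ 2 * (p.h (1 - j) * Y' * (2 * V' + 1)
      - 2 * e' * t ^ 2 * Y' * P')), s ^ 2 * t ^ 2 * (-(2 * e') * t ^ 2 * Y' * Q')⟩ := by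
    change ((‖p.zeta (1 - (1 - j))‖ ^ 2 : ℝ) : ℂ) *
      (((p.U (1 - j) ^ 2 * (2 * p.U (1 - j) ^ 2 - 1) : ℝ) : ℂ)
        + ((aConst m (1 - j) ^ (-(1 / 3) : ℝ) * ‖p.zeta (1 - j)‖ ^ 2 : ℝ) : ℂ)
          * (p.z m (1 - j) * conj (g (1 - j)))) = _
    rw [one_sub_one_sub, hnorm, hnorm', hzg', hU', hrp']
    apply Complex.ext
    · simp only [Complex.re_ofReal_mul, Complex.add_re, Complex.ofReal_re]
      linear_combination s ^ 2 * (2 * V' + 1) * (hV'2 * Y' - (V' - 1) * hY')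
    · simp only [Complex.im_ofReal_mul, Complex.add_im, Complex.ofReal_im]
      ring
  have hX2 : (field m p).2.1 j = s * t ^ 2 * (-(4 * e) * V * P) := by
    change ‖p.zeta (1 - j)‖ ^ 2 * (2 * p.U j ^ 2 * (p.u j * conj (g j)).re) = _
    rw [hnorm', hug, hU, Complex.re_ofReal_mul]
    ring
  have hX2' : (field m p).2.1 (1 - j) = s ^ 2 * (-(4 * e') * t * V' * P') := by
    change ‖p.zeta (1 - (1 - j))‖ ^ 2 * (2 * p.U (1 - j) ^ 2
      * (p.u (1 - j) * conj (g (1 - j))).re) = _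
    rw [one_sub_one_sub, hnorm, hug', hU', Complex.re_ofReal_mul]
    ring
  have hX3 : (field m p).2.2.1 j = s ^ 3 * t ^ 2 * (2 * e * Y * Q) := by
    change ‖p.zeta (1 - j)‖ ^ 2 * (p.h j * (p.zeta j).im
      - ‖p.zeta j‖ ^ 2 * (p.u j * conj (g j)).im / p.U j ^ 2) = _
    rw [hnorm', hnorm, hug, Complex.im_ofReal_mul, div_eq_mul_inv, ← hYU, hs, Complex.ofReal_im]
    ring
  have hX3' : (field m p).2.2.1 (1 - j) = s ^ 2 * t ^ 2 * (2 * e' * t * Y' * Q') := by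
    change ‖p.zeta (1 - (1 - j))‖ ^ 2 * (p.h (1 - j) * (p.zeta (1 - j)).im
      - ‖p.zeta (1 - j)‖ ^ 2 * (p.u (1 - j) * conj (g (1 - j))).im / p.U (1 - j) ^ 2) = _
    rw [one_sub_one_sub, hnorm', hnorm, hug', Complex.im_ofReal_mul, div_eq_mul_inv, ← hYU', ht,
      Complex.ofReal_im]
    ring
  have hX4 : dirX (field m p).2.2.2.1 = (s ^ 2 * t ^ 2) • dirX (muConst m * p.y) := by
    rw [← dirX_smul]
    congr 1
    change ((‖p.zeta 0‖ ^ 2 * ‖p.zeta 1‖ ^ 2 * muConst m : ℝ) : ℂ) * p.y = _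
    rw [hnn]
    push_cast
    ring
  have hX5 : (field m p).2.2.2.2 = ⟨s ^ 2 * t ^ 2 * - interaction (pairMass m j) ψ yr yi 1 0,
      s ^ 2 * t ^ 2 * - interaction (pairMass m j) ψ yr yi 0 1⟩ := by
    change ((‖p.zeta 0‖ ^ 2 * ‖p.zeta 1‖ ^ 2 : ℝ) : ℂ) * gradX m (p.z m) p.x = _
    rw [hnn, hgx]
    apply Complex.ext
    · rw [Complex.re_ofReal_mul]
      congr 1
      simp only [interaction, forceSum, pairMass, Complex.re_sum, Complex.re_ofReal_mul, neg_mul,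
        Finset.sum_neg_distrib]
      simp
    · rw [Complex.im_ofReal_mul]
      congr 1
      simp only [interaction, forceSum, pairMass, Complex.im_sum, Complex.im_ofReal_mul, neg_mul,
        Finset.sum_neg_distrib]
      simp
  rw [phase_eq_sum (field m p) j, hX1, hX1', hX2, hX2', hX3, hX3', hX4, hX5]
  simp only [map_add, map_smul, smul_eq_mul, transport]
  ring

end FourBody

/-! ### Taylor series of the coefficients of the field -/

namespace SmoothFun

open PowerSeries

theorem taylor_congr {f g : SmoothFun (ℝ × ℝ)} (h : f =ᶠ[𝓝 0] g) : taylor f = taylor g := by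
  ext i j
  rw [← sub_eq_zero, ← map_sub, ← map_sub, ← map_sub]
  refine coeff_taylor_eq_zero_of_isBigO (N := i + j + 1) ?_ (Nat.lt_succ_self _)
  have h0 : (f - g : SmoothFun (ℝ × ℝ)) =ᶠ[𝓝[≠] 0] fun _ => (0 : ℝ) := by
    filter_upwards [h.filter_mono nhdsWithin_le_nhds] with q hq
    rw [sub_apply, hq, sub_self]
  exact h0.trans_isBigO (Asymptotics.isBigO_zero _ _)

theorem coeff_zero_zero_taylor (f : SmoothFun (ℝ × ℝ)) :
    coeff 0 (coeff 0 (taylor f)) = f 0 := by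
  rw [coeff_taylor]; simp

theorem exists_inv_sqrt {D : SmoothFun (ℝ × ℝ)} (hD : 0 < D 0) :
    ∃ ψ : SmoothFun (ℝ × ℝ), ∀ᶠ q in 𝓝 0, 0 < D q ∧ ψ q = (√(D q))⁻¹ := by
  have hpos : ∀ᶠ q in 𝓝 (0 : ℝ × ℝ), 0 < D q :=
    (contDiff D).continuous.continuousAt.eventually (lt_mem_nhds hD)
  have hc : ContDiffOn ℝ ∞ (fun q => (√(D q))⁻¹) {q | 0 < D q} := by
    refine ContDiffOn.inv (ContDiffOn.sqrt (contDiff D).contDiffOn fun q hq => ?_) fun q hq => ?_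
    · exact (Set.mem_ofPred.1 hq).ne'
    · exact (Real.sqrt_pos.2 hq).ne'
  obtain ⟨ψ, hψ⟩ := exists_eventuallyEq hc hpos
  exact ⟨ψ, hpos.and hψ⟩

theorem exists_quadratic_root {σ : SmoothFun (ℝ × ℝ)} (hσ : σ 0 = 0) :
    ∃ V Y : SmoothFun (ℝ × ℝ), V 0 = 1 ∧ Y 0 = 1 ∧ ∀ᶠ q in 𝓝 0, V q = (1 + √(1 + 4 * σ q)) / 2 ∧
      V q * Y q = 1 ∧ V q ^ 2 - V q = σ q := by
  have hpos : ∀ᶠ q in 𝓝 (0 : ℝ × ℝ), 0 < 1 + 4 * σ q := by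
    have : ContinuousAt (fun q => 1 + 4 * σ q) 0 :=
      (continuous_const.add (continuous_const.mul (contDiff σ).continuous)).continuousAt
    exact this.eventually (lt_mem_nhds (by simp [hσ]))
  have hc : ContDiffOn ℝ ∞ (fun q => (1 + √(1 + 4 * σ q)) / 2) {q | 0 < 1 + 4 * σ q} := by
    refine ContDiffOn.div_const (contDiffOn_const.add (ContDiffOn.sqrt
      (contDiffOn_const.add (contDiffOn_const.mul (contDiff σ).contDiffOn)) fun q hq => ?_)) 2
    exact (Set.mem_ofPred.1 hq).ne'
  have hc' : ContDiffOn ℝ ∞ (fun q => ((1 + √(1 + 4 * σ q)) / 2)⁻¹) {q | 0 < 1 + 4 * σ q} :=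
    hc.inv fun q _ => by positivity
  obtain ⟨V, hV⟩ := exists_eventuallyEq hc hpos
  obtain ⟨Y, hY⟩ := exists_eventuallyEq hc' hpos
  refine ⟨V, Y, ?_, ?_, ?_⟩
  · rw [hV.self_of_nhds]; norm_num [hσ]
  · rw [hY.self_of_nhds]; norm_num [hσ]
  · filter_upwards [hV, hY, hpos] with q h1 h2 h3
    refine ⟨h1, ?_, ?_⟩
    · rw [h1, h2]
      exact mul_inv_cancel₀ (by positivity)
    · have := Real.sq_sqrt h3.le
      rw [h1]
      linear_combination (1 / 4) * this

end SmoothFun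

theorem map_transport {A B : Type*} [CommRing A] [Algebra ℝ A] [CommRing B] [Algebra ℝ B]
    (f : A →ₐ[ℝ] B)
    (s t b b' l l' β η' ϑ ϑ' cr ci F1 F2 FL FL' Fh Fh' Fθ Fθ' Fx Fr Fi : A) :
    f (transport s t b b' l l' β η' ϑ ϑ' cr ci F1 F2 FL FL' Fh Fh' Fθ Fθ' Fx Fr Fi)
      = transport (f s) (f t) (f b) (f b') (f l) (f l') (f β) (f η') (f ϑ) (f ϑ') (f cr) (f ci)
        (f F1) (f F2) (f FL) (f FL') (f Fh) (f Fh') (f Fθ) (f Fθ') (f Fx) (f Fr) (f Fi) := by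
  simp [transport]

namespace FourBody

/-- The leading coefficient of `h_j'`. -/
def leadingCoeff (m : Fin 4 → ℝ) (j : Fin 2) (p : Phase) : ℝ :=
  - (4 * (aConst m j ^ (1 / 3 : ℝ))⁻¹) *
    ((∑ i, bodyMass m j i * sepCoef m j i ^ 2) * (∑ k, bodyMass m (1 - j) k) *
      (((axis m j (p.theta j)).re ^ 2 + (axis m j (p.theta j)).im ^ 2) * ‖p.x‖⁻¹ ^ 3
        - 3 * ‖p.x‖⁻¹ ^ 5 * ((axis m j (p.theta j)).re * p.x.re
          + (axis m j (p.theta j)).im * p.x.im) ^ 2))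

/-- The quartic coefficient that couples the two binaries. -/
def mixedCoeff (m : Fin 4 → ℝ) (j : Fin 2) (p : Phase) : ℝ :=
  let w := axis m j (p.theta j)
  let w' := axis m (1 - j) (p.theta (1 - j))
  (∑ i, bodyMass m j i * sepCoef m j i ^ 2) *
    (∑ k, bodyMass m (1 - j) k * sepCoef m (1 - j) k ^ 2) *
    quarticCoeff ‖p.x‖⁻¹ (w.re * p.x.re + w.im * p.x.im) (w'.re * p.x.re + w'.im * p.x.im)
      (w.re * w'.re + w.im * w'.im) (w.re ^ 2 + w.im ^ 2) (w'.re ^ 2 + w'.im ^ 2)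

theorem mixedCoeff_one_sub (m : Fin 4 → ℝ) (j : Fin 2) (p : Phase) :
    mixedCoeff m (1 - j) p = mixedCoeff m j p := by
  simp only [mixedCoeff, one_sub_one_sub, quarticCoeff]
  ring

section PlanePoint

variable (b : Phase) (j : Fin 2) (q : ℝ × ℝ)

/-- The point with coordinates `q` in the plane of radial variables through `b`. -/
def planePoint : Phase := b + q.1 • dirI j + q.2 • dirI (1 - j)

theorem planePoint_zeta (hb : b.zeta = 0) : (planePoint b j q).zeta j = q.1 := by
  have h1 : b.1 j = 0 := congrFun hb j
  simp [planePoint, Phase.zeta, dirI, h1, (one_sub_ne j).symm]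

theorem planePoint_zeta_one_sub (hb : b.zeta = 0) : (planePoint b j q).zeta (1 - j) = q.2 := by
  have h1 : b.1 (1 - j) = 0 := congrFun hb (1 - j)
  simp [planePoint, Phase.zeta, dirI, h1, one_sub_ne j]

theorem planePoint_h : (planePoint b j q).h = b.h := by simp [planePoint, Phase.h, dirI]
theorem planePoint_theta : (planePoint b j q).theta = b.theta := by
  simp [planePoint, Phase.theta, dirI]
theorem planePoint_x : (planePoint b j q).x = b.x := by simp [planePoint, Phase.x, dirI]
theorem planePoint_y : (planePoint b j q).y = b.y := by simp [planePoint, Phase.y, dirI]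

end PlanePoint

open PowerSeries SmoothFun

/-- The Taylor series of the coefficients of the rescaled field. -/
structure FieldSeries (m : Fin 4 → ℝ) (j : Fin 2) (b : Phase)
    (B B' l l' β η' ϑ ϑ' cr ci : SmoothFun (ℝ × ℝ)) : Prop where
  field_eq : ∀ F : SmoothFun Phase, ∀ᶠ q in 𝓝 (0 : ℝ × ℝ),
    fderiv ℝ F (planePoint b j q) (field m (planePoint b j q))
      = transport fst snd B B' l l' β η' ϑ ϑ' cr ci
        (res b (dirI j) (dirI (1 - j)) (dir (dirI j) F))
        (res b (dirI j) (dirI (1 - j)) (dir (dirI (1 - j)) F))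
        (res b (dirI j) (dirI (1 - j)) (dir (dirL j) F))
        (res b (dirI j) (dirI (1 - j)) (dir (dirL (1 - j)) F))
        (res b (dirI j) (dirI (1 - j)) (dir (dirH j) F))
        (res b (dirI j) (dirI (1 - j)) (dir (dirH (1 - j)) F))
        (res b (dirI j) (dirI (1 - j)) (dir (dirT j) F))
        (res b (dirI j) (dirI (1 - j)) (dir (dirT (1 - j)) F))
        (res b (dirI j) (dirI (1 - j)) (dir (dirX (muConst m * b.y)) F))
        (res b (dirI j) (dirI (1 - j)) (dir (dirY 1) F))
        (res b (dirI j) (dirI (1 - j)) (dir (dirY Complex.I) F)) q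
  coeff_zero_β : coeff 0 (taylor β) = 0
  coeff_one_β : coeff 1 (taylor β) = 0
  coeff_zero_ϑ : coeff 0 (taylor ϑ) = 0
  coeff_one_B' : coeff 1 (taylor B') = 0
  coeff_one_l' : coeff 1 (taylor l') = 0
  coeff_one_η' : coeff 1 (taylor η') = 0
  coeff_one_ϑ' : coeff 1 (taylor ϑ') = 0
  coeff_one_cr : coeff 1 (taylor cr) = 0
  coeff_one_ci : coeff 1 (taylor ci) = 0
  coeff_two_β₀ : coeff 0 (coeff 2 (taylor β)) = leadingCoeff m j b
  coeff_two_β₁ : coeff 1 (coeff 2 (taylor β)) = 0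
  coeff_two_β₂ : coeff 2 (coeff 2 (taylor β)) = 0
  coeff_two_β₃ : coeff 3 (coeff 2 (taylor β)) = 0
  coeff_two_β₄ : coeff 4 (coeff 2 (taylor β))
    = 8 * (aConst m j ^ (1 / 3 : ℝ))⁻¹ * mixedCoeff m j b

/-- In the chosen coefficients `s` enters only through s², so linear parts vanish. The forces on the
`j`-th binary vanish at s = 0, which gives the constant parts of `β` and `ϑ`. Square roots are
replaced by smooth germs, and their algebraic equations determine the series. -/
theorem exists_fieldSeries {m : Fin 4 → ℝ} (hm : ∀ i, 0 < m i) (j : Fin 2) {b : Phase}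
    (hb : b.zeta = 0) (hx : b.x ≠ 0) : ∃ B B' l l' β η' ϑ ϑ' cr ci,
      FieldSeries m j b B B' l l' β η' ϑ ϑ' cr ci := by
  obtain ⟨V, Y, hV0, hY0, hVY⟩ := exists_quadratic_root
    (σ := algebraMap ℝ _ (b.h j) * fst ^ 2) (by simp)
  obtain ⟨V', Y', hV'0, hY'0, hVY'⟩ := exists_quadratic_root
    (σ := algebraMap ℝ _ (b.h (1 - j)) * snd ^ 2) (by simp)
  set w := axis m j (b.theta j) with hw
  set w' := axis m (1 - j) (b.theta (1 - j)) with hw'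
  set α := sepCoef m j with hα
  set α' := sepCoef m (1 - j) with hα'
  set S : SmoothFun (ℝ × ℝ) := fst ^ 2 * Y with hS
  set S' : SmoothFun (ℝ × ℝ) := snd ^ 2 * Y' with hS'
  set yr := sepCoord b.x.re w.re w'.re α α' S S' with hyr
  set yi := sepCoord b.x.im w.im w'.im α α' S S' with hyi
  have hD : ∀ i k, (yr i k ^ 2 + yi i k ^ 2 : SmoothFun (ℝ × ℝ)) 0 = ‖b.x‖ ^ 2 := by
    intro i k
    rw [← Complex.normSq_eq_norm_sq, Complex.normSq_apply]
    simp [hyr, hyi, sepCoord, hS, hS']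
    ring
  have hDpos : ∀ i k, 0 < (yr i k ^ 2 + yi i k ^ 2 : SmoothFun (ℝ × ℝ)) 0 := by
    intro i k
    rw [hD]
    have := norm_pos_iff.2 hx
    positivity
  choose ψ hψ using fun i k => exists_inv_sqrt (hDpos i k)
  set e : ℝ := (aConst m j ^ (1 / 3 : ℝ))⁻¹ with he
  set e' : ℝ := (aConst m (1 - j) ^ (1 / 3 : ℝ))⁻¹ with he'
  set P := interaction (fun i k => pairMass m j i k * α i) ψ yr yi w.re w.im with hP
  set Q := interaction (fun i k => pairMass m j i k * α i) ψ yr yi w.im (-w.re) with hQ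
  set P' := interaction (fun i k => pairMass m j i k * α' k) ψ yr yi w'.re w'.im with hP'
  set Q' := interaction (fun i k => pairMass m j i k * α' k) ψ yr yi w'.im (-w'.re) with hQ'
  let K := algebraMap ℝ (SmoothFun (ℝ × ℝ))
  have hTV : taylor V ^ 2 - taylor V = C (C (b.h j)) * X ^ 2 := by
    have := taylor_congr (f := V ^ 2 - V) (g := algebraMap ℝ _ (b.h j) * fst ^ 2)
      (by filter_upwards [hVY] with q hq; exact hq.2.2)
    simpa only [map_sub, map_pow, map_mul, AlgHom.commutes, taylor_fst, algebraMap_eq_C_C]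
      using this
  have hTV' : taylor V' ^ 2 - taylor V' = C (C (b.h (1 - j)) * X ^ 2) := by
    have := taylor_congr (f := V' ^ 2 - V') (g := algebraMap ℝ _ (b.h (1 - j)) * snd ^ 2)
      (by filter_upwards [hVY'] with q hq; exact hq.2.2)
    simpa only [map_sub, map_pow, map_mul, AlgHom.commutes, taylor_snd, algebraMap_eq_C_C]
      using this
  have hTY : taylor V * taylor Y = 1 := by
    have := taylor_congr (f := V * Y) (g := 1) (by filter_upwards [hVY] with q hq; exact hq.2.1)
    simpa only [map_mul, map_one] using this
  have hTY' : taylor V' * taylor Y' = 1 := by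
    have := taylor_congr (f := V' * Y') (g := 1) (by filter_upwards [hVY'] with q hq; exact hq.2.1)
    simpa only [map_mul, map_one] using this
  obtain ⟨cV0, cV1⟩ := coeff_of_sq_sub_self hTV (by rw [coeff_zero_zero_taylor, hV0])
  obtain ⟨cV'1, cV'2⟩ := coeff_of_sq_sub_self_C hTV' (by rw [coeff_zero_zero_taylor, hV'0])
  have cY0 : coeff 0 (taylor Y) = 1 := by
    have := congrArg (coeff 0) hTY
    rw [coeff_zero_mul', cV0, one_mul] at this
    rw [this]; simp
  have cY1 := coeff_one_of_mul_eq_one hTY cV1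
  have cY'1 := coeff_one_of_mul_eq_one hTY' cV'1
  have cY'2 := coeff_two_of_mul_eq_one hTY' cV'1 cV'2
  have cη : coeff 0 (coeff 0 (taylor Y')) = 1 := by rw [coeff_zero_zero_taylor, hY'0]
  have hTS : taylor S = X ^ 2 * taylor Y := by rw [hS, map_mul, map_pow, taylor_fst]
  have hTS' : taylor S' = C (X ^ 2) * taylor Y' := by
    rw [hS', map_mul, map_pow, taylor_snd, map_pow]
  have cS0 : coeff 0 (taylor S) = 0 := by rw [hTS, coeff_X_pow_mul']; simp
  have cS1 : coeff 1 (taylor S) = 0 := by rw [hTS, coeff_X_pow_mul']; simp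
  have cS2 : coeff 2 (taylor S) = 1 := by rw [hTS, coeff_X_pow_mul', if_pos le_rfl, cY0]
  have cS'0 : coeff 0 (taylor S') = X ^ 2 * coeff 0 (taylor Y') := by rw [hTS', coeff_C_mul]
  have cS'1 : coeff 1 (taylor S') = 0 := by rw [hTS', coeff_C_mul, cY'1, mul_zero]
  have cS'2 : coeff 2 (taylor S') = 0 := by rw [hTS', coeff_C_mul, cY'2, mul_zero]
  have hTyr : ∀ i k, taylor (yr i k)
      = sepCoord b.x.re w.re w'.re α α' (taylor S) (taylor S') i k := fun i k => by
    rw [hyr, map_sepCoord]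
  have hTyi : ∀ i k, taylor (yi i k)
      = sepCoord b.x.im w.im w'.im α α' (taylor S) (taylor S') i k := fun i k => by
    rw [hyi, map_sepCoord]
  have hψ0 : ∀ i k, coeff 0 (coeff 0 (taylor (ψ i k))) = ‖b.x‖⁻¹ := fun i k => by
    rw [coeff_zero_zero_taylor, (hψ i k).self_of_nhds.2, hD, Real.sqrt_sq (norm_nonneg _)]
  have hTψ : ∀ i k, taylor (ψ i k) ^ 2 *
      (sepCoord b.x.re w.re w'.re α α' (taylor S) (taylor S') i k ^ 2
        + sepCoord b.x.im w.im w'.im α α' (taylor S) (taylor S') i k ^ 2) = 1 := fun i k => by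
    have := taylor_congr (f := ψ i k ^ 2 * (yr i k ^ 2 + yi i k ^ 2)) (g := 1) (by
      filter_upwards [hψ i k] with q hq
      change ψ i k q ^ 2 * (yr i k ^ 2 + yi i k ^ 2 : SmoothFun (ℝ × ℝ)) q = 1
      rw [hq.2, inv_pow, Real.sq_sqrt hq.1.le, inv_mul_cancel₀ hq.1.ne'])
    simpa only [map_mul, map_pow, map_add, map_one, hTyr, hTyi] using this
  obtain ⟨cψ1, cP0, G, hG, cG0, cG1, cG2, cG3, cG4⟩ := coeff_forceSum cS0 cS1 cS2 cS'1 cS'2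
    (sum_bodyMass_mul_sepCoef hm j) (sum_bodyMass_mul_sepCoef hm (1 - j)) cη cS'0 hx hψ0 hTψ
  have hTint : ∀ c u v, taylor (interaction c ψ yr yi u v) = forceSum c (fun i k => taylor (ψ i k))
      (fun i k => algebraMap ℝ _ u * sepCoord b.x.re w.re w'.re α α' (taylor S) (taylor S') i k
        + algebraMap ℝ _ v * sepCoord b.x.im w.im w'.im α α' (taylor S) (taylor S') i k) := by
    intro c u v
    rw [map_interaction]
    simp only [interaction, hTyr, hTyi]
  have cint1 : ∀ c u v, coeff 1 (taylor (interaction c ψ yr yi u v)) = 0 := by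
    intro c u v
    rw [hTint]
    refine coeff_one_forceSum cψ1 fun i k => ?_
    rw [map_add, algebraMap_eq_C_C, algebraMap_eq_C_C, coeff_C_mul, coeff_C_mul,
      coeff_one_sepCoord cS1 cS'1, coeff_one_sepCoord cS1 cS'1]
    simp
  have cTP0 : coeff 0 (taylor P) = 0 := by rw [hP, hTint]; exact cP0 _ _
  have cTQ0 : coeff 0 (taylor Q) = 0 := by rw [hQ, hTint]; exact cP0 _ _
  have cTP1 : coeff 1 (taylor P) = 0 := cint1 _ _ _
  have cTP2 : coeff 2 (taylor P) = G := by rw [hP, hTint, hG]; rfl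
  have hsnd : taylor (snd ^ 2) = C (X ^ 2) := by rw [map_pow, taylor_snd, map_pow]
  have cβ2 : coeff 2 (taylor (K (-(4 * e)) * V * P)) = C (-(4 * e)) * G := by
    simp only [K, map_mul, AlgHom.commutes, algebraMap_eq_C_C, mul_assoc, coeff_C_mul,
      coeff_two_mul', cTP0, cTP1, cTP2, cV0]
    simp
  refine ⟨K (b.h j) * Y * (K 2 * V + 1) - K (2 * e) * fst ^ 2 * Y * P,
    K (b.h (1 - j)) * Y' * (K 2 * V' + 1) - K (2 * e') * snd ^ 2 * Y' * P',
    K (-(2 * e)) * Y * Q, K (-(2 * e')) * snd ^ 2 * Y' * Q', K (-(4 * e)) * V * P,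
    K (-(4 * e')) * snd * V' * P', K (2 * e) * Y * Q, K (2 * e') * snd * Y' * Q',
    - interaction (pairMass m j) ψ yr yi 1 0, - interaction (pairMass m j) ψ yr yi 0 1, ?_⟩
  constructor
  · intro F
    filter_upwards [hVY, hVY', Filter.eventually_all.2 fun i => Filter.eventually_all.2 (hψ i)]
      with q hq hq' hqψ
    have hzs := planePoint_zeta b j q hb
    have hzt := planePoint_zeta_one_sub b j q hb
    have key := field_plane hm (p := planePoint b j q) (V := V q) (Y := Y q) (V' := V' q)
      (Y' := Y' q) hzs hzt (by rw [planePoint_h]; exact hq.1) (by rw [planePoint_h]; exact hq'.1)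
      hq.2.1 hq'.2.1 (by rw [planePoint_h]; exact hq.2.2) (by rw [planePoint_h]; exact hq'.2.2)
      (w := w) (w' := w') (by rw [planePoint_theta]) (by rw [planePoint_theta])
      (yr := fun i k => yr i k q) (yi := fun i k => yi i k q) (ψ := fun i k => ψ i k q)
      (by rw [planePoint_x]; rfl) (by rw [planePoint_x]; rfl)
      (fun i k => (hqψ i k).2) (fun i k => (hqψ i k).1) he he' rfl rfl rfl rfl
      (fderiv ℝ F (planePoint b j q))
    rw [key, planePoint_h, planePoint_y]
    conv_rhs => rw [← eval_apply, map_transport]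
    simp only [K, map_mul, map_sub, map_add, map_neg, map_one, map_pow,
      AlgHom.commutes, hP, hQ, hP', hQ',
      map_interaction, Algebra.algebraMap_self, RingHom.id_apply]
    rfl
  · simp only [K, map_mul, AlgHom.commutes, algebraMap_eq_C_C, mul_assoc, coeff_C_mul,
      coeff_zero_mul', cTP0, mul_zero]
  · simp only [K, map_mul, AlgHom.commutes, algebraMap_eq_C_C, mul_assoc, coeff_C_mul,
      coeff_one_mul', cTP0, cTP1, mul_zero, add_zero]
  · simp only [K, map_mul, AlgHom.commutes, algebraMap_eq_C_C, mul_assoc, coeff_C_mul,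
      coeff_zero_mul', cTQ0, mul_zero]
  · simp only [K, map_mul, map_sub, map_add, map_one, AlgHom.commutes, algebraMap_eq_C_C,
      mul_assoc, coeff_C_mul, coeff_one_mul', cV'1, cY'1, hsnd, hP', cint1]
    simp [coeff_one]
  · simp only [K, map_mul, AlgHom.commutes, algebraMap_eq_C_C,
      mul_assoc, coeff_C_mul, coeff_one_mul', cY'1, hsnd, hQ', cint1]
    simp
  · simp only [K, map_mul, AlgHom.commutes, algebraMap_eq_C_C,
      mul_assoc, coeff_C_mul, coeff_one_mul', cV'1, taylor_snd, hP', cint1]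
    simp
  · simp only [K, map_mul, AlgHom.commutes, algebraMap_eq_C_C,
      mul_assoc, coeff_C_mul, coeff_one_mul', cY'1, taylor_snd, hQ', cint1]
    simp
  · rw [map_neg, map_neg, cint1, neg_zero]
  · rw [map_neg, map_neg, cint1, neg_zero]
  · rw [cβ2, coeff_C_mul, cG0]
    rfl
  · rw [cβ2, coeff_C_mul, cG1, mul_zero]
  · rw [cβ2, coeff_C_mul, cG2, mul_zero]
  · rw [cβ2, coeff_C_mul, cG3, mul_zero]
  · rw [cβ2, coeff_C_mul, cG4]
    simp only [mixedCoeff]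
    ring

end FourBody

/-! ### Relations forced on an invariant function -/

namespace SmoothFun

theorem dir_eq_zero_of_eventually {E : Type*} [NormedAddCommGroup E] [NormedSpace ℝ E]
    {f : SmoothFun E} {b v : E} (h : ∀ᶠ ε in 𝓝 (0 : ℝ), f (b + ε • v) = 0) : dir v f b = 0 := by
  have h1 : HasDerivAt (fun ε : ℝ => b + ε • v) v 0 := by
    simpa using ((hasDerivAt_id (0 : ℝ)).smul_const v).const_add b
  have h2 := (differentiable f (b + (0 : ℝ) • v)).hasFDerivAt.comp_hasDerivAt (0 : ℝ) h1
  have h3 : (f : E → ℝ) ∘ (fun ε : ℝ => b + ε • v) =ᶠ[𝓝 0] fun _ => 0 := h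
  have h4 := h2.unique ((hasDerivAt_const (0 : ℝ) (0 : ℝ)).congr_of_eventuallyEq h3)
  rw [zero_smul, add_zero] at h4
  exact h4

end SmoothFun

namespace FourBody

open PowerSeries SmoothFun

theorem continuous_U (j : Fin 2) : Continuous fun q : Phase => q.U j := by
  unfold Phase.U Phase.h Phase.zeta
  fun_prop

theorem continuous_z (m : Fin 4 → ℝ) (j : Fin 2) : Continuous fun q : Phase => q.z m j := by
  have h1 : Continuous fun q : Phase => aConst m j ^ (1 / 3 : ℝ) / q.U j :=
    continuous_const.div (continuous_U j) fun q => U_pos.ne'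
  have h2 : Continuous fun q : Phase => q.theta j := by unfold Phase.theta; fun_prop
  have h3 : Continuous fun q : Phase => q.zeta j := by unfold Phase.zeta; fun_prop
  unfold Phase.z
  fun_prop

theorem eventually_sepLC_ne_zero (m : Fin 4 → ℝ) (j : Fin 2) {b : Phase} (hb : b ∈ collisionSet) :
    ∀ᶠ q in 𝓝 b, ∀ i k, sepLC m j (q.z m) q.x i k ≠ 0 := by
  refine Filter.eventually_all.2 fun i => Filter.eventually_all.2 fun k => ?_
  have hc : Continuous fun q : Phase => sepLC m j (q.z m) q.x i k := by
    have := continuous_z m j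
    have := continuous_z m (1 - j)
    have h3 : Continuous fun q : Phase => q.x := by unfold Phase.x; fun_prop
    unfold sepLC
    fun_prop
  refine hc.continuousAt.eventually_ne ?_
  have h0 : ∀ i, b.zeta i = 0 := fun i => congrFun hb.1 i
  simpa [sepLC, Phase.z, h0] using hb.2

/-- The coupling depends on z_j through z_j², so its gradient in z_j vanishes with z_j. The
remaining components contain |ζ_j|² or Im ζ_j. -/
theorem field_of_zeta_eq_zero {m : Fin 4 → ℝ} {j : Fin 2} {q : Phase} (hq : q.zeta j = 0)
    (h0 : ∀ i k, sepLC m j (q.z m) q.x i k ≠ 0) :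
    field m q = (‖q.zeta (1 - j)‖ ^ 2) • dirI j := by
  have hg : gradZ m (q.z m) q.x j = 0 := by
    rw [gradZ_eq m (q.z m) q.x j h0]
    simp [Phase.z, hq]
  have hU : q.U j = 1 := by simp [Phase.U, hq]
  have hnn : ‖q.zeta 0‖ ^ 2 * ‖q.zeta 1‖ ^ 2 = 0 := by
    fin_cases j <;> simp_all
  have h1 : (field m q).1 j = ((‖q.zeta (1 - j)‖ ^ 2 : ℝ) : ℂ) := by
    simp [field, hg, hU]; norm_num
  have h1' : (field m q).1 (1 - j) = 0 := by
    simp [field, hq]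
  have h2 : (field m q).2.1 j = 0 := by simp [field, hg]
  have h2' : (field m q).2.1 (1 - j) = 0 := by simp [field, hq]
  have h3 : (field m q).2.2.1 j = 0 := by simp [field, hq]
  have h3' : (field m q).2.2.1 (1 - j) = 0 := by simp [field, hq]
  have h4 : (field m q).2.2.2.1 = 0 := by
    change ((‖q.zeta 0‖ ^ 2 * ‖q.zeta 1‖ ^ 2 * muConst m : ℝ) : ℂ) * q.y = 0
    rw [hnn]; simp
  have h5 : (field m q).2.2.2.2 = 0 := by
    change ((‖q.zeta 0‖ ^ 2 * ‖q.zeta 1‖ ^ 2 : ℝ) : ℂ) * _ = 0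
    rw [hnn]; simp
  rw [phase_eq_sum (field m q) j, h1, h1', h2, h2', h3, h3', h4, h5]
  rw [Complex.ofReal_re, Complex.ofReal_im]
  simp [dirX]

/-- The points of the collision set near which `F` is invariant at order `8`. -/
def invariantSet (m : Fin 4 → ℝ) (F : SmoothFun Phase) : Set Phase :=
  {b | b ∈ collisionSet ∧ IsInvariantAtOrder (field m) F 8 b}

variable {m : Fin 4 → ℝ} {F : SmoothFun Phase} {b : Phase}

/-- The invariant set is relatively open in the collision set: a bound on a neighbourhood of `b` is
also a bound near each nearby point. Identities on it can therefore be differentiated in tangent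
directions. -/
theorem eventually_mem_invariantSet (hb : b ∈ invariantSet m F) :
    ∀ᶠ q in 𝓝 b, q.zeta = 0 → q ∈ invariantSet m F := by
  obtain ⟨⟨_, hx⟩, hO⟩ := hb
  obtain ⟨c, hc⟩ := hO.isBigOWith
  have h1 := Filter.Eventually.eventually_nhds hc.bound
  have hcx : Continuous fun q : Phase => q.x := by unfold Phase.x; fun_prop
  filter_upwards [h1, hcx.continuousAt.eventually_ne hx] with q hq hqx hq0
  exact ⟨⟨hq0, hqx⟩, Asymptotics.IsBigO.of_bound c hq⟩

theorem eventually_line_mem_invariantSet (hb : b ∈ invariantSet m F) {v : Phase}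
    (hv : v.zeta = 0) : ∀ᶠ ε in 𝓝 (0 : ℝ), b + ε • v ∈ invariantSet m F := by
  have hc : Filter.Tendsto (fun ε : ℝ => b + ε • v) (𝓝 0) (𝓝 b) := by
    have : Continuous fun ε : ℝ => b + ε • v := by fun_prop
    simpa using this.tendsto 0
  filter_upwards [hc.eventually (eventually_mem_invariantSet hb)] with ε hε
  refine hε ?_
  have h1 : b.1 = 0 := hb.1.1
  have h2 : v.1 = 0 := hv
  simp [Phase.zeta, h1, h2]

theorem dir_eq_zero_of_invariantSet {f : SmoothFun Phase} (hf : ∀ b ∈ invariantSet m F, f b = 0)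
    (hb : b ∈ invariantSet m F) {v : Phase} (hv : v.zeta = 0) : dir v f b = 0 :=
  dir_eq_zero_of_eventually
    ((eventually_line_mem_invariantSet hb hv).mono fun _ hε => hf _ hε)

/-- Where ζ_j = 0 the field is |ζ_{1-j}|² ∂/∂I_j; division of the order 10 bound by this factor
leaves order 8 for ∂F/∂I_j. Derivatives in L_{1-j} are included because the L_{1-j} component of the
field also has to be discarded later. -/
theorem iterate_dir_eq_zero (hb : b ∈ invariantSet m F) (j : Fin 2) {i k : ℕ} (hik : i + k < 8) :
    ((dir (dirL (1 - j)))^[k] ((dir (dirI (1 - j)))^[i] (dir (dirI j) F))) b = 0 := by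
  obtain ⟨hbC, hO⟩ := hb
  have hb0 : ∀ i, b.1 i = 0 := fun i => congrFun hbC.1 i
  let γ : ℝ × ℝ → Phase := fun q => b + q.1 • dirI (1 - j) + q.2 • dirL (1 - j)
  have hγ : Filter.Tendsto γ (𝓝 0) (𝓝 b) := by
    have : Continuous γ := by fun_prop
    simpa [γ] using this.tendsto 0
  have hzj : ∀ q, (γ q).zeta j = 0 := by
    intro q
    simp [γ, Phase.zeta, dirI, dirL, hb0, one_sub_ne j]
  have hzj' : ∀ q, (γ q).zeta (1 - j) = q.1 + q.2 * Complex.I := by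
    intro q
    simp [γ, Phase.zeta, dirI, dirL, hb0]
  have hnorm : ∀ q, ‖(γ q).zeta (1 - j)‖ ≤ 2 * ‖q‖ := by
    intro q
    rw [hzj']
    refine (norm_add_le _ _).trans ?_
    have h1 := norm_fst_le q
    have h2 := norm_snd_le q
    rw [norm_mul, Complex.norm_I, mul_one, Complex.norm_real, Complex.norm_real]
    linarith
  have hzn : ∀ q, ‖(γ q).zeta‖ = ‖(γ q).zeta (1 - j)‖ := by
    intro q
    refine le_antisymm ((pi_norm_le_iff_of_nonneg (norm_nonneg _)).2 fun i => ?_)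
      (norm_le_pi_norm _ _)
    rcases eq_or_ne i j with rfl | hi
    · rw [hzj, norm_zero]; exact norm_nonneg _
    · have : i = 1 - j := by fin_cases i <;> fin_cases j <;> simp_all
      rw [this]
  obtain ⟨c, hc⟩ := (hO.comp_tendsto hγ).isBigOWith
  have key : (res b (dirI (1 - j)) (dirL (1 - j)) (dir (dirI j) F) : ℝ × ℝ → ℝ)
      =O[𝓝[≠] 0] fun q => ‖q‖ ^ 8 := by
    refine Asymptotics.IsBigO.of_bound (c * 2 ^ 8) ?_
    have hsep := hγ.eventually (eventually_sepLC_ne_zero m j hbC)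
    filter_upwards [hc.bound.filter_mono nhdsWithin_le_nhds, hsep.filter_mono nhdsWithin_le_nhds,
      self_mem_nhdsWithin] with q hq hs hq0
    have hf := field_of_zeta_eq_zero (hzj q) hs
    have hpos : 0 < ‖(γ q).zeta (1 - j)‖ := by
      rw [norm_pos_iff, hzj']
      intro h
      apply hq0
      have h1 := congrArg Complex.re h
      have h2 := congrArg Complex.im h
      simp at h1 h2
      exact Prod.ext h1 h2
    simp only [Function.comp, hf, map_smul, hzn, smul_eq_mul, norm_mul, norm_pow, norm_norm] at hq
    have h2 : ‖fderiv ℝ F (γ q) (dirI j)‖ ≤ c * ‖(γ q).zeta (1 - j)‖ ^ 8 := by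
      refine le_of_mul_le_mul_left ?_ (pow_pos hpos 2)
      refine hq.trans_eq ?_
      ring
    have hc0 : 0 ≤ c := by
      by_contra hneg
      have := mul_neg_of_neg_of_pos (not_le.1 hneg) (pow_pos hpos 8)
      linarith [norm_nonneg (fderiv ℝ F (γ q) (dirI j))]
    change ‖fderiv ℝ F (γ q) (dirI j)‖ ≤ _
    refine h2.trans ?_
    rw [norm_pow, norm_norm, mul_assoc, ← mul_pow]
    exact mul_le_mul_of_nonneg_left (pow_le_pow_left₀ (norm_nonneg _) (hnorm q) 8) hc0
  have h := coeff_taylor_eq_zero_of_isBigO key hik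
  rw [coeff_taylor_res] at h
  have h1 : ((i.factorial : ℝ)⁻¹) * ((k.factorial : ℝ)⁻¹) ≠ 0 := by positivity
  exact (mul_eq_zero.1 h).resolve_left h1

theorem coeff_coeff_one_taylor_res (j : Fin 2) (v : Phase) (k : ℕ) :
    coeff k (coeff 1 (taylor (res b (dirI j) (dirI (1 - j)) (dir v F))))
      = ((k.factorial : ℝ)⁻¹) * dir v ((dir (dirI (1 - j)))^[k] (dir (dirI j) F)) b := by
  rw [coeff_taylor_res, dir_iterate_comm, Function.iterate_one, dir_comm]
  simp

theorem X_pow_dvd_coeff_zero_radial (hb : b ∈ invariantSet m F) (j : Fin 2) :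
    X ^ 7 ∣ coeff 0 (taylor (res b (dirI j) (dirI (1 - j)) (dir (dirI j) F))) := by
  refine X_pow_dvd_iff.2 fun k hk => ?_
  have := iterate_dir_eq_zero hb j (i := k) (k := 0) (by omega)
  rw [coeff_taylor_res]
  simp only [Function.iterate_zero, id] at this ⊢
  rw [this, mul_zero]

theorem X_pow_dvd_coeff_one_dirI (hb : b ∈ invariantSet m F) (j : Fin 2) :
    X ^ 7 ∣ coeff 1 (taylor (res b (dirI j) (dirI (1 - j)) (dir (dirI (1 - j)) F))) := by
  refine X_pow_dvd_iff.2 fun k hk => ?_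
  have := iterate_dir_eq_zero hb j (i := k + 1) (k := 0) (by omega)
  rw [Function.iterate_zero, id, Function.iterate_succ_apply'] at this
  rw [coeff_coeff_one_taylor_res, this, mul_zero]

theorem X_pow_dvd_coeff_one_dirL (hb : b ∈ invariantSet m F) (j : Fin 2) :
    X ^ 7 ∣ coeff 1 (taylor (res b (dirI j) (dirI (1 - j)) (dir (dirL (1 - j)) F))) := by
  refine X_pow_dvd_iff.2 fun k hk => ?_
  have := iterate_dir_eq_zero hb j (i := k) (k := 1) (by omega)
  rw [Function.iterate_one] at this
  rw [coeff_coeff_one_taylor_res, this, mul_zero]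

/-- The s-linear part of ∂_v F is ∂_v of the t-expansion of ∂F/∂I_j at s = 0. Its low coefficients
vanish on all of the invariant set, hence so do their tangential derivatives. -/
theorem X_pow_dvd_coeff_one_tangent (hb : b ∈ invariantSet m F) (j : Fin 2) {v : Phase}
    (hv : v.zeta = 0) :
    X ^ 7 ∣ coeff 1 (taylor (res b (dirI j) (dirI (1 - j)) (dir v F))) := by
  refine X_pow_dvd_iff.2 fun k hk => ?_
  rw [coeff_coeff_one_taylor_res, dir_eq_zero_of_invariantSet (F := F) (m := m) ?_ hb hv, mul_zero]
  exact fun b' hb' => iterate_dir_eq_zero hb' j (i := k) (k := 0) (by omega)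

theorem norm_zeta_planePoint_le (j : Fin 2) (hb : b.zeta = 0) (q : ℝ × ℝ) :
    ‖(planePoint b j q).zeta‖ ≤ ‖q‖ := by
  refine (pi_norm_le_iff_of_nonneg (norm_nonneg _)).2 fun i => ?_
  rcases eq_or_ne i j with rfl | hi
  · rw [planePoint_zeta _ _ _ hb, Complex.norm_real]
    exact norm_fst_le q
  · have : i = 1 - j := by fin_cases i <;> fin_cases j <;> simp_all
    rw [this, planePoint_zeta_one_sub _ _ _ hb, Complex.norm_real]
    exact norm_snd_le q

theorem exists_X_pow_dvd (hm : ∀ i, 0 < m i) (hb : b ∈ invariantSet m F) (j : Fin 2) :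
    ∃ W : ℝ⟦X⟧, coeff 0 W = leadingCoeff m j b ∧ coeff 1 W = 0 ∧ coeff 2 W = 0 ∧ coeff 3 W = 0 ∧
      coeff 4 W = 8 * (aConst m j ^ (1 / 3 : ℝ))⁻¹ * mixedCoeff m j b ∧
      X ^ 5 ∣ coeff 3 (taylor (res b (dirI j) (dirI (1 - j)) (dir (dirI j) F)))
        + W * coeff 0 (taylor (res b (dirI j) (dirI (1 - j)) (dir (dirH j) F))) := by
  obtain ⟨B, B', l, l', β, η', ϑ, ϑ', cr, ci, h⟩ := exists_fieldSeries hm j hb.1.1 hb.1.2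
  refine ⟨coeff 2 (taylor β), h.coeff_two_β₀, h.coeff_two_β₁, h.coeff_two_β₂, h.coeff_two_β₃,
    h.coeff_two_β₄, ?_⟩
  refine X_pow_dvd_transport (t := X) (B := taylor B) (l := taylor l)
    (FL := taylor (res b (dirI j) (dirI (1 - j)) (dir (dirL j) F)))
    (Fθ := taylor (res b (dirI j) (dirI (1 - j)) (dir (dirT j) F))) rfl
    h.coeff_zero_β h.coeff_one_β h.coeff_zero_ϑ h.coeff_one_B'
    h.coeff_one_l' h.coeff_one_η' h.coeff_one_ϑ' h.coeff_one_cr h.coeff_one_ci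
    (X_pow_dvd_coeff_zero_radial hb j) (X_pow_dvd_coeff_one_dirI hb j)
    (X_pow_dvd_coeff_one_dirL hb j)
    (X_pow_dvd_coeff_one_tangent hb j (v := dirH (1 - j)) rfl)
    (X_pow_dvd_coeff_one_tangent hb j (v := dirT (1 - j)) rfl)
    (X_pow_dvd_coeff_one_tangent hb j (v := dirX (muConst m * b.y)) rfl)
    (X_pow_dvd_coeff_one_tangent hb j (v := dirY 1) rfl)
    (X_pow_dvd_coeff_one_tangent hb j (v := dirY Complex.I) rfl) fun i k hik => ?_
  rw [← taylor_fst, ← taylor_snd, ← map_transport]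
  refine coeff_taylor_eq_zero_of_isBigO (N := 10) ?_ hik
  have hγ : Filter.Tendsto (planePoint b j) (𝓝 0) (𝓝 b) := by
    have : Continuous (planePoint b j) := by unfold planePoint; fun_prop
    simpa [planePoint] using this.tendsto 0
  refine Asymptotics.IsBigO.mono ?_ nhdsWithin_le_nhds
  refine Asymptotics.IsBigO.congr' ?_ (h.field_eq F) Filter.EventuallyEq.rfl
  refine (hb.2.comp_tendsto hγ).trans (Asymptotics.IsBigO.of_bound 1 ?_)
  refine Filter.Eventually.of_forall fun q => ?_
  rw [one_mul, norm_pow, norm_norm, Function.comp, norm_pow, norm_norm]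
  exact pow_le_pow_left₀ (norm_nonneg _) (norm_zeta_planePoint_le j hb.1.1 q) 10

theorem leading_relation (hm : ∀ i, 0 < m i) (hb : b ∈ invariantSet m F) (j : Fin 2) :
    1 / 6 * ((dir (dirI j))^[4] F) b + leadingCoeff m j b * dir (dirH j) F b = 0 := by
  obtain ⟨W, h0, -, -, -, -, hd⟩ := exists_X_pow_dvd hm hb j
  have h := X_pow_dvd_iff.1 hd 0 (by norm_num)
  rw [map_add, coeff_taylor_res, coeff_zero_mul', coeff_taylor_res, h0] at h
  simp only [Function.iterate_zero, id, ← Function.iterate_succ_apply] at h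
  norm_num [Nat.factorial] at h ⊢
  exact h

theorem mixed_relation (hm : ∀ i, 0 < m i) (hb : b ∈ invariantSet m F) (j : Fin 2) :
    1 / 144 * ((dir (dirI (1 - j)))^[4] ((dir (dirI j))^[4] F)) b
      + leadingCoeff m j b * (1 / 24 * ((dir (dirI (1 - j)))^[4] (dir (dirH j) F)) b)
      + 8 * (aConst m j ^ (1 / 3 : ℝ))⁻¹ * mixedCoeff m j b * dir (dirH j) F b = 0 := by
  obtain ⟨W, h0, h1, h2, h3, h4, hd⟩ := exists_X_pow_dvd hm hb j
  -- At t⁴ only the constant and quartic coefficients of `W` take part; the factor 1/144 is 1/(3!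
  -- 4!).
  have h := X_pow_dvd_iff.1 hd 4 (by norm_num)
  rw [map_add, coeff_taylor_res, coeff_mul,
    Finset.Nat.sum_antidiagonal_eq_sum_range_succ_mk] at h
  simp only [Finset.sum_range_succ, Finset.sum_range_zero, h0, h1, h2, h3, h4, zero_mul, zero_add,
    add_zero, coeff_taylor_res, Nat.sub_self, Nat.sub_zero] at h
  rw [← Function.iterate_succ_apply (f := dir (dirI j))] at h
  simp only [Function.iterate_zero, id] at h
  norm_num [Nat.factorial] at h ⊢
  linear_combination h

theorem leadingCoeff_add_smul_dirH (m : Fin 4 → ℝ) (j k : Fin 2) (b : Phase) (ε : ℝ) :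
    leadingCoeff m j (b + ε • dirH k) = leadingCoeff m j b := by
  simp [leadingCoeff, Phase.theta, Phase.x, dirH]

/-- The derivative ∂_{I_1}⁴∂_{I_2}⁴F is computed from either binary. Once the leading relations are
inserted, both values contain the same multiple of ∂_{h_1}∂_{h_2}F, and the difference retains only
the mixed terms. -/
theorem mixedCoeff_mul_eq (hm : ∀ i, 0 < m i) (hb : b ∈ invariantSet m F) (j : Fin 2) :
    mixedCoeff m j b * ((aConst m j ^ (1 / 3 : ℝ))⁻¹ * dir (dirH j) F b
      - (aConst m (1 - j) ^ (1 / 3 : ℝ))⁻¹ * dir (dirH (1 - j)) F b) = 0 := by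
  -- The leading relation of the other binary, differentiated along h_j; its coefficient is constant
  -- in that direction.
  have hder : ∀ j, 1 / 6 * ((dir (dirI (1 - j)))^[4] (dir (dirH j) F)) b
      + leadingCoeff m (1 - j) b * dir (dirH j) (dir (dirH (1 - j)) F) b = 0 := by
    intro j
    have h := dir_eq_zero_of_eventually (b := b) (v := dirH j)
      (f := (1 / 6 : ℝ) • (dir (dirI (1 - j)))^[4] F
        + leadingCoeff m (1 - j) b • dir (dirH (1 - j)) F)
      ((eventually_line_mem_invariantSet hb rfl).mono fun ε hε => by
        have := leading_relation hm hε (1 - j)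
        rw [leadingCoeff_add_smul_dirH] at this
        exact this)
    rw [map_add, Derivation.map_smul, Derivation.map_smul, dir_iterate_comm] at h
    exact h
  have hswap : (dir (dirI (1 - j)))^[4] ((dir (dirI j))^[4] F)
      = (dir (dirI j))^[4] ((dir (dirI (1 - j)))^[4] F) :=
    Function.Commute.iterate_iterate (fun f => dir_comm _ _ f) 4 4 F
  have r1 := mixed_relation hm hb j
  have r2 := mixed_relation hm hb (1 - j)
  have d1 := hder j
  have d2 := hder (1 - j)
  rw [one_sub_one_sub] at r2 d2
  rw [mixedCoeff_one_sub] at r2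
  rw [hswap] at r1
  rw [dir_comm] at d2
  linear_combination (1 / 8) * (r1 - r2) - (1 / 32) * leadingCoeff m j b * d1
    + (1 / 32) * leadingCoeff m (1 - j) b * d2

end FourBody

/-! ### Non-vanishing of the mixed coefficient, and passage from foliations to functions -/

namespace FourBody

open SmoothFun

/-- `quarticCoeff` as a function of vectors. -/
def quarticForm (x w w' : ℂ) : ℝ :=
  quarticCoeff ‖x‖⁻¹ (w.re * x.re + w.im * x.im) (w'.re * x.re + w'.im * x.im)
    (w.re * w'.re + w.im * w'.im) (w.re ^ 2 + w.im ^ 2) (w'.re ^ 2 + w'.im ^ 2)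

theorem quarticForm_comm (x w w' : ℂ) : quarticForm x w w' = quarticForm x w' w := by
  simp only [quarticForm, quarticCoeff]
  ring

/-- The form is quadratic in `w`, so the terms bilinear in `w` and i w cancel between opposite
rotations. Zeros at three nearby angles thus force a zero at the quarter turn. -/
theorem quarticForm_rotate (x w w' : ℂ) (C S : ℝ) :
    quarticForm x (⟨C, S⟩ * w) w' + quarticForm x (⟨C, -S⟩ * w) w'
      = 2 * C ^ 2 * quarticForm x w w' + 2 * S ^ 2 * quarticForm x (Complex.I * w) w' := by
  simp only [quarticForm, quarticCoeff, Complex.mul_re, Complex.mul_im, Complex.I_re, Complex.I_im]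
  ring

/-- The form is a quarter of ∂_w²∂_{w'}²(1/|x|), so the double trace is a quarter of |w|²|w'|²
Δ²(1/|x|). In the plane Δ r^(-1) = r^(-3) and Δ r^(-3) = 9 r^(-5). -/
theorem quarticForm_trace {x : ℂ} (hx : x ≠ 0) (w w' : ℂ) :
    quarticForm x w w' + quarticForm x (Complex.I * w) w' + (quarticForm x w (Complex.I * w')
      + quarticForm x (Complex.I * w) (Complex.I * w'))
      = 9 / 4 * ‖x‖⁻¹ ^ 5 * (‖w‖ ^ 2 * ‖w'‖ ^ 2) := by
  have h : ‖x‖⁻¹ ^ 2 * (x.re ^ 2 + x.im ^ 2) = 1 := by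
    rw [pow_two x.re, pow_two x.im, ← Complex.normSq_apply, Complex.normSq_eq_norm_sq, ← mul_pow,
      inv_mul_cancel₀ (norm_ne_zero_iff.2 hx), one_pow]
  rw [← Complex.normSq_eq_norm_sq, ← Complex.normSq_eq_norm_sq, Complex.normSq_apply,
    Complex.normSq_apply]
  simp only [quarticForm, quarticCoeff, Complex.mul_re, Complex.mul_im, Complex.I_re, Complex.I_im]
  generalize ‖x‖⁻¹ = ρ at *
  linear_combination (w.re ^ 2 + w.im ^ 2) * (w'.re ^ 2 + w'.im ^ 2) * ρ ^ 5 *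
    (105 / 4 * (ρ ^ 2 * (x.re ^ 2 + x.im ^ 2)) - 15 / 4) * h

theorem quarticForm_I_mul_eq_zero {x w : ℂ} {C S : ℝ} (hS : S ≠ 0) {w' : ℂ}
    (h0 : quarticForm x w w' = 0) (h1 : quarticForm x (⟨C, S⟩ * w) w' = 0)
    (h2 : quarticForm x (⟨C, -S⟩ * w) w' = 0) : quarticForm x (Complex.I * w) w' = 0 := by
  have h := quarticForm_rotate x w w' C S
  rw [h0, h1, h2] at h
  have : 2 * S ^ 2 ≠ 0 := by positivity
  exact (mul_eq_zero.1 (show 2 * S ^ 2 * _ = (0 : ℝ) by linarith)).resolve_left this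

theorem axis_ne_zero {m : Fin 4 → ℝ} (hm : ∀ i, 0 < m i) (j : Fin 2) (θ : ℝ) : axis m j θ ≠ 0 := by
  have h1 := massProd_pos hm j
  have h2 := redMass_pos hm j
  have h3 := Real.rpow_pos_of_pos (aConst_pos hm j) (1 / 3)
  have h4 : (aConst m j ^ (1 / 3 : ℝ)) ^ 2 / (2 * (4 * massProd m j * redMass m j)) ≠ 0 := by
    positivity
  exact mul_ne_zero (Complex.ofReal_ne_zero.2 h4) (pow_ne_zero _ (Complex.exp_ne_zero _))

theorem axis_add (m : Fin 4 → ℝ) (j : Fin 2) (θ ε : ℝ) :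
    axis m j (θ + ε) = ⟨Real.cos (2 * ε), Real.sin (2 * ε)⟩ * axis m j θ := by
  have h : (⟨Real.cos (2 * ε), Real.sin (2 * ε)⟩ : ℂ) = Complex.exp (ε * Complex.I) ^ 2 := by
    rw [← Complex.exp_nat_mul]
    have : ((2 : ℕ) : ℂ) * (ε * Complex.I) = ((2 * ε : ℝ) : ℂ) * Complex.I := by push_cast; ring
    rw [this]
    apply Complex.ext
    · rw [Complex.exp_ofReal_mul_I_re]
    · rw [Complex.exp_ofReal_mul_I_im]
  rw [h, axis, axis, Complex.ofReal_add, add_mul, Complex.exp_add]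
  ring

theorem mixedCoeff_eq_zero_iff {m : Fin 4 → ℝ} (hm : ∀ i, 0 < m i) (j : Fin 2) (p : Phase) :
    mixedCoeff m j p = 0 ↔
      quarticForm p.x (axis m j (p.theta j)) (axis m (1 - j) (p.theta (1 - j))) = 0 := by
  have h1 := sum_bodyMass_mul_sepCoef_sq_pos hm j
  have h2 := sum_bodyMass_mul_sepCoef_sq_pos hm (1 - j)
  exact ⟨fun h => (mul_eq_zero.1 h).resolve_left (mul_pos h1 h2).ne', fun h => by
    change _ * quarticForm _ _ _ = 0
    rw [h, mul_zero]⟩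

/-- The angles vary freely on the collision set, and each turns its axis at double speed. Vanishing
for small angles extends to quarter turns of both axes, first in `w` and then in `w'`, and
contradicts the positive trace. -/
theorem not_eventually_mixedCoeff_eq_zero {m : Fin 4 → ℝ} (hm : ∀ i, 0 < m i) (j : Fin 2)
    {p : Phase} (hp : p ∈ collisionSet) :
    ¬ ∀ᶠ b in 𝓝 p, b ∈ collisionSet → mixedCoeff m j b = 0 := by
  intro h
  let γ : ℝ × ℝ → Phase := fun q => p + q.1 • dirT j + q.2 • dirT (1 - j)
  have hγ : Filter.Tendsto γ (𝓝 0) (𝓝 p) := by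
    have : Continuous γ := by fun_prop
    simpa [γ] using this.tendsto 0
  have hγC : ∀ q, γ q ∈ collisionSet := by
    intro q
    refine ⟨?_, ?_⟩
    · have : p.1 = 0 := hp.1
      simp [γ, Phase.zeta, dirT, this]
    · have := hp.2
      simpa [γ, Phase.x, dirT] using this
  obtain ⟨r, hr, hball⟩ := Metric.eventually_nhds_iff.1 (hγ.eventually h)
  set w := axis m j (p.theta j) with hw
  set w' := axis m (1 - j) (p.theta (1 - j)) with hw'
  have hzero : ∀ ε δ : ℝ, |ε| < r → |δ| < r → quarticForm p.x
      (⟨Real.cos (2 * ε), Real.sin (2 * ε)⟩ * w) (⟨Real.cos (2 * δ), Real.sin (2 * δ)⟩ * w')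
      = 0 := by
    intro ε δ hε hδ
    have hd : dist ((ε, δ) : ℝ × ℝ) 0 < r := by
      rw [dist_zero_right]
      exact max_lt hε hδ
    have h1 := (mixedCoeff_eq_zero_iff hm j _).1 (hball hd (hγC _))
    have ht : (γ (ε, δ)).theta j = p.theta j + ε := by
      simp [γ, Phase.theta, dirT, (one_sub_ne j).symm]
    have ht' : (γ (ε, δ)).theta (1 - j) = p.theta (1 - j) + δ := by
      simp [γ, Phase.theta, dirT, one_sub_ne j]
    have hx : (γ (ε, δ)).x = p.x := by simp [γ, Phase.x, dirT]
    rwa [ht, ht', hx, axis_add, axis_add] at h1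
  -- The cap 1 keeps 2ε strictly between 0 and π, so that the sine is nonzero.
  set ε : ℝ := min (r / 2) 1 with hε
  have hε0 : 0 < ε := lt_min (by positivity) one_pos
  have hεr : |ε| < r := by
    rw [abs_of_pos hε0]
    exact (min_le_left _ _).trans_lt (by linarith)
  have hε1 : ε ≤ 1 := min_le_right _ _
  have hS : Real.sin (2 * ε) ≠ 0 :=
    (Real.sin_pos_of_pos_of_lt_pi (by linarith) (by linarith [Real.pi_gt_three])).ne'
  have hnε : |-ε| < r := by rwa [abs_neg]
  have h00 : |(0 : ℝ)| < r := by rwa [abs_zero]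
  have hone : (⟨Real.cos (2 * 0), Real.sin (2 * 0)⟩ : ℂ) = 1 := by
    apply Complex.ext <;> simp
  have hneg : (⟨Real.cos (2 * -ε), Real.sin (2 * -ε)⟩ : ℂ)
      = ⟨Real.cos (2 * ε), -Real.sin (2 * ε)⟩ := by
    apply Complex.ext <;> simp
  have hleft : ∀ δ, |δ| < r →
      quarticForm p.x w (⟨Real.cos (2 * δ), Real.sin (2 * δ)⟩ * w') = 0 := by
    intro δ hδ
    have := hzero 0 δ h00 hδ
    rwa [hone, one_mul] at this
  have hI : ∀ δ, |δ| < r → quarticForm p.x (Complex.I * w)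
      (⟨Real.cos (2 * δ), Real.sin (2 * δ)⟩ * w') = 0 := by
    intro δ hδ
    have h2 := hzero (-ε) δ hnε hδ
    rw [hneg] at h2
    exact quarticForm_I_mul_eq_zero hS (hleft δ hδ) (hzero ε δ hεr hδ) h2
  have hright : ∀ v, (∀ δ, |δ| < r → quarticForm p.x v
      (⟨Real.cos (2 * δ), Real.sin (2 * δ)⟩ * w') = 0) →
      quarticForm p.x v w' = 0 ∧ quarticForm p.x v (Complex.I * w') = 0 := by
    intro v hv
    have h1 := hv 0 h00
    have h2 := hv ε hεr
    have h3 := hv (-ε) hnε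
    rw [hone, one_mul] at h1
    rw [hneg] at h3
    refine ⟨h1, ?_⟩
    rw [quarticForm_comm] at h1 h2 h3 ⊢
    exact quarticForm_I_mul_eq_zero hS h1 h2 h3
  have htr := quarticForm_trace hp.2 w w'
  rw [(hright _ hleft).1, (hright _ hleft).2, (hright _ hI).1, (hright _ hI).2] at htr
  have h1 := norm_pos_iff.2 (axis_ne_zero hm j (p.theta j))
  have h2 := norm_pos_iff.2 (axis_ne_zero hm (1 - j) (p.theta (1 - j)))
  have h3 := norm_pos_iff.2 hp.2
  have : 0 < 9 / 4 * ‖p.x‖⁻¹ ^ 5 * (‖w‖ ^ 2 * ‖w'‖ ^ 2) := by positivity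
  linarith

theorem not_mem_invariantSet {m : Fin 4 → ℝ} (hm : ∀ i, 0 < m i) (j : Fin 2) {p : Phase}
    {F : SmoothFun Phase} (hF : ∀ k, dir (dirH k) F p = if k = j then 1 else 0) :
    p ∉ invariantSet m F := by
  intro hp
  refine not_eventually_mixedCoeff_eq_zero hm j hp.1 ?_
  let f : SmoothFun Phase := (aConst m j ^ (1 / 3 : ℝ))⁻¹ • dir (dirH j) F
      - (aConst m (1 - j) ^ (1 / 3 : ℝ))⁻¹ • dir (dirH (1 - j)) F
  have hf : f p ≠ 0 := by
    have : f p = (aConst m j ^ (1 / 3 : ℝ))⁻¹ * dir (dirH j) F p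
      - (aConst m (1 - j) ^ (1 / 3 : ℝ))⁻¹ * dir (dirH (1 - j)) F p := rfl
    rw [this, hF, hF, if_pos rfl, if_neg (one_sub_ne j), mul_one, mul_zero, sub_zero]
    exact inv_ne_zero (Real.rpow_pos_of_pos (aConst_pos hm j) _).ne'
  filter_upwards [eventually_mem_invariantSet hp,
    (contDiff f).continuous.continuousAt.eventually_ne hf] with b hb hfb hbC
  exact (mul_eq_zero.1 (mixedCoeff_mul_eq hm (hb hbC.1) j)).resolve_right hfb

theorem not_isInvariantAtOrder {m : Fin 4 → ℝ} (hm : ∀ i, 0 < m i) {p : Phase}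
    (hp : p ∈ collisionSet) {U : Set Phase} (hU : U ∈ 𝓝 p) (j : Fin 2) {F : Phase → ℝ}
    (hF : ContDiffOn ℝ ∞ F U) (hd : ∀ k, fderiv ℝ F p (dirH k) = if k = j then 1 else 0) :
    ¬ IsInvariantAtOrder (field m) F 8 p := by
  intro hO
  obtain ⟨f, hf⟩ := exists_eventuallyEq hF hU
  have hfd := hf.fderiv (𝕜 := ℝ)
  refine not_mem_invariantSet hm j (p := p) (F := f) (fun k => ?_) ⟨hp, ?_⟩
  · rw [dir_apply, hfd.self_of_nhds, hd]
  · refine Asymptotics.IsBigO.congr' hO ?_ Filter.EventuallyEq.rfl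
    filter_upwards [hfd] with q hq
    rw [hq]

/-- Transversality makes `A` injective on the h-plane, which lies in the tangent space of the
collision set; a coordinate of a linear left inverse is the required functional. -/
theorem exists_clm_apply_dirH {N : Type*} [NormedAddCommGroup N] [NormedSpace ℝ N]
    [FiniteDimensional ℝ N] {A : Phase →L[ℝ] N}
    (hA : Disjoint (LinearMap.ker (A : Phase →ₗ[ℝ] N)) collisionTangent) (j : Fin 2) :
    ∃ l : N →L[ℝ] ℝ, ∀ k, l (A (dirH k)) = if k = j then 1 else 0 := by
  let i : (Fin 2 → ℝ) →ₗ[ℝ] Phase := LinearMap.inr ℝ (Fin 2 → ℂ) _ ∘ₗ LinearMap.inl ℝ _ _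
  have hker : LinearMap.ker ((A : Phase →ₗ[ℝ] N) ∘ₗ i) = ⊥ := by
    refine LinearMap.ker_eq_bot'.2 fun c hc => ?_
    have h0 : i c = 0 := Submodule.disjoint_def.1 hA (i c) hc rfl
    exact congrArg (fun p : Phase => p.2.1) h0
  obtain ⟨g, hg⟩ := LinearMap.exists_leftInverse_of_injective _ hker
  refine ⟨(LinearMap.proj j ∘ₗ g).toContinuousLinearMap, fun k => ?_⟩
  have h : g (A (dirH k)) = Pi.single k 1 := LinearMap.congr_fun hg (Pi.single k 1)
  change g (A (dirH k)) j = _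
  rw [h, Pi.single_apply]
  simp only [eq_comm]

end FourBody

end

theorem mainTheorem6 (m : Fin 4 → ℝ) (hm : ∀ i, 0 < m i) :
    (∀ U : Set FourBody.Phase, IsOpen U → (U ∩ FourBody.collisionSet).Nonempty →
      ¬ ∃ 𝓕 : SmoothFoliation U (EuclideanSpace ℝ (Fin 8)),
          𝓕.IsInvariant (FourBody.field m) ∧
          𝓕.IsNormalTo FourBody.collisionSet FourBody.collisionTangent) ∧
    (∀ p ∈ FourBody.collisionSet, ∀ U : Set FourBody.Phase, IsOpen U → p ∈ U → ∀ j : Fin 2,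
      ¬ ∃ F : FourBody.Phase → ℝ, ContDiffOn ℝ ∞ F U ∧
          (∀ k : Fin 2, fderiv ℝ F p (FourBody.dirH k) = if k = j then 1 else 0) ∧
          FourBody.IsInvariantAtOrder (FourBody.field m) F 8 p) := by
  refine ⟨?_, ?_⟩
  · rintro U - ⟨p, hpU, hpC⟩ ⟨𝓕, hinv, hnorm⟩
    rw [← 𝓕.iUnion_dom] at hpU
    obtain ⟨i, hi⟩ := Set.mem_iUnion.1 hpU
    have hnhds := (𝓕.isOpen_dom i).mem_nhds hi
    -- Either index would do: composed with the chart, `l` gives an exact first integral, so the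
    -- order 8 condition holds with left-hand side identically zero near `p`.
    obtain ⟨l, hl⟩ := FourBody.exists_clm_apply_dirH (hnorm i p ⟨hi, hpC⟩).disjoint 0
    have hfd : ∀ q ∈ 𝓕.dom i, fderiv ℝ (l ∘ 𝓕.chart i) q = l.comp (fderiv ℝ (𝓕.chart i) q) := by
      intro q hq
      have hq' := (𝓕.isOpen_dom i).mem_nhds hq
      exact (l.hasFDerivAt.comp q (((𝓕.smooth i).contDiffAt hq').differentiableAt
        (by simp)).hasFDerivAt).fderiv
    refine FourBody.not_isInvariantAtOrder hm hpC hnhds 0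
      (l.contDiff.comp_contDiffOn (𝓕.smooth i)) (fun k => ?_) ?_
    · rw [hfd p hi]
      exact hl k
    · refine Filter.EventuallyEq.trans_isBigO (f₂ := fun _ => (0 : ℝ)) ?_
        (Asymptotics.isBigO_zero _ _)
      filter_upwards [hnhds] with q hq
      rw [hfd q hq, ContinuousLinearMap.comp_apply, hinv i q hq, map_zero]
  · rintro p hp U hU hpU j ⟨F, hF, hd, hO⟩
    exact FourBody.not_isInvariantAtOrder hm hp (hU.mem_nhds hpU) j hF hd hO
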